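/- Let $T$ be a complete first-order theory in a countable language $L$ and let $P$ be any unary predicate symbol of $L$. For a model $M$ of $T$ write $P^M$ for the set named by $P$. A subset $A\subseteq M$ is \emph{complete} if for every $L$-formula $\psi(\bar x,\bar y)$ and every tuple $\bar b$ from $A$: if $M\models\psi(\bar a,\bar b)$ for some tuple $\bar a$ from $P^M$, then $M\models\psi(\bar a,\bar b)$ for some tuple $\bar a$ from $A\cap P^M$. The set $A$ has the \emph{existence property} if, in some elementary extension $C$ of $M$, there is an elementary submodel $N\preceq C$ with $A\subseteq N$ and $P^N=A\cap P^M$. The theory $T$ has the \emph{full existence property} (over $P$) if every complete subset of every model of $T$ has the existence property. For $M\models T$, let $M|_P$ be the substructure of $M$ with universe $P^M$ (in general, the substructure generated by $P^M$). We say that $T$ has \emph{uniform reduction} over $P$ if in every model $M$ of $T$ every subset of a power of $P^M$ that is $0$-definable in $M$ is $0$-definable in $M|_P$. Let $T^P=\mathrm{Th}(M|_P)$, where $M\models T$; $T$ has the \emph{Gaifman property} if every model of $T^P$ is isomorphic to $N|_P$ for some $N\models T$. 1. (Lachlan) If $T$ is stable (no formula has the order property in a model of $T$), then $T$ has the full existence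 property. Moreover, let $T'$ be the Morleyization of $T$, that is, $T$ together with a new predicate $R_\varphi$ and the axiom $\forall\bar x\,(R_\varphi(\bar x)\leftrightarrow\varphi(\bar x))$ for each $L$-formula $\varphi(\bar x)$. If $T$ is stable, then $T'$ is a complete stable theory in a countable language; $P$ is stably embedded in $T'$ (in each model of $T'$, subsets of powers of $P$ that are definable with parameters are definable with parameters from $P$); $T'$ has uniform reduction over $P$; and modulo $T'$ every formula is equivalent to a predicate. For each model $M$ of $T$, its expansion $M'$ by $R_\varphi\mapsto\varphi(M)$ is a model of $T'$, and a set $A\subseteq M$ is complete in $M$ if and only if it is complete in $M'$. 2. If $T$ is any complete theory of abelian groups in the language of groups with an additional unary predicate $P$ that picks out a subgroup, then $T$ has the full existence property. If, in addition, $T$ has uniform reduction over $P$, then $T$ has the Gaifman property. -/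

import Mathlib

open FirstOrder FirstOrder.Language Set

universe u v w

namespace OverPredicate

section Basic

variable {L : FirstOrder.Language.{u, v}}

/-- The set `P^M` named by the unary predicate `P` in the structure `M`. -/
def predSet (P : L.Relations 1) (M : Type w) [L.Structure M] : Set M :=
  {x | Structure.RelMap P ![x]}

/-- A subset `A` of the structure `M` is complete (the pair `(P, A)` has the Tarski-Vaught
property): for every formula `ψ(x̄, ȳ)` and every tuple `b̄` from `A`, if `ψ(x̄, b̄)` has a solution
in `P^M`, then it has a solution in `A ∩ P^M`. -/
def IsCompleteSet (P : L.Relations 1) {M : Type w} [L.Structure M] (A : Set M) : Prop :=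
  ∀ (m n : ℕ) (ψ : L.Formula (Fin m ⊕ Fin n)) (b : Fin n → M), (∀ i, b i ∈ A) →
    (∃ a : Fin m → M, (∀ i, a i ∈ predSet P M) ∧ ψ.Realize (Sum.elim a b)) →
    ∃ a : Fin m → M, (∀ i, a i ∈ A ∩ predSet P M) ∧ ψ.Realize (Sum.elim a b)

/-- A subset `A` of the structure `M` has the existence property over `P`: some model `N` contains
`A` and has the same `P`-part as `A`. In place of a fixed monster model, `N` is an elementary
substructure of an elementary extension `C` of `M`, so that types of tuples from `A` are
unchanged. -/
def HasExistenceProperty (P : L.Relations 1) {M : Type w} [L.Structure M] (A : Set M) : Prop :=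
  ∃ (C : Type w) (_ : L.Structure C) (j : M ↪ₑ[L] C) (N : L.ElementarySubstructure C),
    j '' A ⊆ (N : Set C) ∧ (N : Set C) ∩ predSet P C = j '' A ∩ predSet P C

/-- `T` has the full existence property over `P`: every complete subset of a model of `T` has the
existence property. -/
def HasFullExistence (T : L.Theory) (P : L.Relations 1) : Prop :=
  ∀ (M : Type w) [L.Structure M] [M ⊨ T] [Nonempty M] (A : Set M),
    IsCompleteSet P A → HasExistenceProperty P A

/-- `T` is stable: no formula `φ(x̄, ȳ)` has the order property in a model of `T`. -/
def IsStable (T : L.Theory) : Prop :=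
  ∀ (m n : ℕ) (φ : L.Formula (Fin m ⊕ Fin n)) (M : Type w) [L.Structure M] [M ⊨ T] [Nonempty M],
    ¬ ∃ (a : ℕ → Fin m → M) (b : ℕ → Fin n → M),
      ∀ i j, φ.Realize (Sum.elim (a i) (b j)) ↔ i < j

/-- The substructure `M|_P` of `M` on the `P`-part of `M`. Its universe is `P^M` as soon as `P^M` is
closed under the function symbols of the language (e.g. when there are none, or when `P` names a
subgroup of a group); in general it is the substructure generated by `P^M`. -/
def predPart (P : L.Relations 1) (M : Type w) [L.Structure M] : L.Substructure M :=
  Substructure.closure L (predSet P M)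

/-- `P` is stably embedded: subsets of (powers of) `P` that are definable with parameters are
definable with parameters from `P`. -/
def IsStablyEmbedded (T : L.Theory) (P : L.Relations 1) : Prop :=
  ∀ (M : Type w) [L.Structure M] [M ⊨ T] [Nonempty M] (n : ℕ) (S : Set (Fin n → M)),
    (∀ a ∈ S, ∀ i, a i ∈ predSet P M) →
    (Set.univ : Set M).Definable L S → (predSet P M).Definable L S

/-- Uniform reduction: subsets of (powers of) `P^M` that are `0`-definable in `M` are `0`-definable
in the structure `M|_P`. -/
def HasUniformReduction (T : L.Theory) (P : L.Relations 1) : Prop :=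
  ∀ (M : Type w) [L.Structure M] [M ⊨ T] [Nonempty M] (n : ℕ) (S : Set (Fin n → M)),
    (∀ a ∈ S, ∀ i, a i ∈ predSet P M) →
    (∅ : Set M).Definable L S →
    (∅ : Set (predPart P M)).Definable L {a : Fin n → predPart P M | (fun i => (a i : M)) ∈ S}

/-- Quantifier elimination down to the level of predicates: modulo `T`, every formula is equivalent
to a single predicate of the language. -/
def HasPredicateElimination (T : L.Theory) : Prop :=
  ∀ (n : ℕ) (φ : L.Formula (Fin n)), ∃ R : L.Relations n, φ ⇔[T] R.formula Term.var

/-- `T` has the Gaifman property over `P`: every model `N` of `T^P`, the theory of the `P`-part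
of a model of `T`, is (up to isomorphism) the `P`-part of a model of `T`. -/
def HasGaifmanProperty (T : L.Theory) (P : L.Relations 1) : Prop :=
  ∀ (C : Type w) [L.Structure C] [C ⊨ T] [Nonempty C] (N : Type w) [L.Structure N],
    N ⊨ L.completeTheory (predPart P C) →
    ∃ (M : Type w) (_ : L.Structure M), M ⊨ T ∧ Nonempty M ∧ Nonempty (N ≃[L] predPart P M)

end Basic

section Morley

/-- The language with one `n`-ary predicate for each `L`-formula in `n` variables. -/
def formulaPredicates (L : FirstOrder.Language.{u, v}) : FirstOrder.Language.{0, max u v} :=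
  ⟨fun _ => Empty, fun n => L.Formula (Fin n)⟩

/-- The language of the Morleyization: `L` with a new predicate for each `L`-formula. -/
abbrev morleyLanguage (L : FirstOrder.Language.{u, v}) : FirstOrder.Language.{u, max u v} :=
  L.sum (formulaPredicates L)

/-- The predicate of the language of the Morleyization that names the formula `φ`. -/
def formulaPred {L : FirstOrder.Language.{u, v}} {n : ℕ} (φ : L.Formula (Fin n)) :
    (morleyLanguage L).Relations n :=
  Sum.inr φ

/-- Every `L`-structure is expanded to the language of the Morleyization (through
`Language.sumStructure`) by interpreting the predicate that names `φ` as the set defined by `φ`. -/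
instance formulaPredicatesStructure {L : FirstOrder.Language.{u, v}} {M : Type w} [L.Structure M] :
    (formulaPredicates L).Structure M where
  funMap := fun f => Empty.elim f
  RelMap := fun {n} (φ : L.Formula (Fin n)) x => φ.Realize x

/-- The Morleyization of `T`: the theory `T` with the axioms `∀ x̄, R_φ(x̄) ↔ φ(x̄)`, for every
`L`-formula `φ`, where `R_φ` is the predicate that names `φ`. -/
noncomputable def morleyization {L : FirstOrder.Language.{u, v}} (T : L.Theory) : (morleyLanguage L).Theory :=
  LHom.sumInl.onTheory T ∪
    {σ | ∃ (n : ℕ) (φ : L.Formula (Fin n)), σ = Formula.iAlls (Fin n)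
      (Formula.relabel (Sum.inr : Fin n → Empty ⊕ Fin n)
        ((formulaPred φ).formula Term.var ⇔ LHom.sumInl.onFormula φ))}

end Morley

section Groups

/-- The function symbols of (additively written) groups. -/
inductive GroupFunc : ℕ → Type
  | zero : GroupFunc 0
  | neg : GroupFunc 1
  | add : GroupFunc 2

/-- A single unary predicate symbol. -/
inductive GroupRel : ℕ → Type
  | pred : GroupRel 1

/-- The language of groups with an additional unary predicate. -/
def groupLanguage : FirstOrder.Language.{0, 0} :=
  ⟨GroupFunc, GroupRel⟩

/-- The distinguished predicate of `groupLanguage`. -/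
def groupPred : groupLanguage.Relations 1 :=
  GroupRel.pred

/-- The operations of a `groupLanguage`-structure, `0`, `-x` and `x + y`. -/
def gzero (M : Type w) [groupLanguage.Structure M] : M :=
  Structure.funMap (L := groupLanguage) GroupFunc.zero ![]

/-- See `gzero`. -/
def gneg {M : Type w} [groupLanguage.Structure M] (x : M) : M :=
  Structure.funMap (L := groupLanguage) GroupFunc.neg ![x]

/-- See `gzero`. -/
def gadd {M : Type w} [groupLanguage.Structure M] (x y : M) : M :=
  Structure.funMap (L := groupLanguage) GroupFunc.add ![x, y]

/-- The structure `M` is an abelian group in which the predicate picks out a subgroup. -/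
structure IsAbelianGroupWithSubgroup (M : Type w) [groupLanguage.Structure M] : Prop where
  add_assoc : ∀ x y z : M, gadd (gadd x y) z = gadd x (gadd y z)
  add_comm : ∀ x y : M, gadd x y = gadd y x
  zero_add : ∀ x : M, gadd (gzero M) x = x
  neg_add : ∀ x : M, gadd (gneg x) x = gzero M
  zero_mem : gzero M ∈ predSet groupPred M
  neg_mem : ∀ x ∈ predSet groupPred M, gneg x ∈ predSet groupPred M
  add_mem : ∀ x ∈ predSet groupPred M, ∀ y ∈ predSet groupPred M,
    gadd x y ∈ predSet groupPred M

end Groups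

end OverPredicate

open OverPredicate

/-! For stable theories the argument builds a model around the complete set `A` one element at a
time, without enlarging its `P`-part. Stability bounds the height of binary trees of instances of a
formula (`exists_not_treeRank_of_isStable`). A consistent formula of minimal rank therefore decides
all instances of a given `χ` at once, and since the language is countable, iteration extends every
consistent formula to a locally isolated type: for each `χ`, one formula of the type decides all
instances of `χ` (`exists_locally_isolated`). Adjoining a realization of such a type keeps the set
complete, because a requirement on the new element is reduced through one isolating formula to
completeness of the old set; the same argument shows that a new element in `P` would equal an old
one (`IsCompleteDiagram.exists_extend`). Choosing the types to contain Henkin axioms and applying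
Zorn's lemma gives a set closed under witnesses, hence an elementary submodel by Tarski-Vaught. The
types are carried by filters on assignments of names into `M` and are realized in ultrapowers.

The same rank yields definability of types, hence stable embeddedness. The claims about the
Morleyization follow from a translation of its formulas back to `L` and from the fact that its
models are exactly the canonical expansions.

For groups, every formula defines a Boolean combination of subgroups
(`isSubgroupCombination_of_formula`). The quantifier step rests on Neumann's lemma and
inclusion-exclusion. Such combinations cannot order an array of sums `a i + b j`, so the theory is
stable and full existence follows. For the Gaifman property, a model of `T^P` is embedded in `P` of
an ultrapower; uniform reduction makes its image complete, and full existence supplies a model with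
exactly this `P`-part. -/

namespace OverPredicate

/-! ### Binary tree rank and ladders -/

section TreeRank

variable {X Y : Type*}

/-- `treeRank χ B k Z` says that there is a full binary tree of height `k` of instances of `χ` with
parameters from `B` all of whose branches are realized in `Z`. -/
def treeRank (χ : X → Y → Prop) (B : Set Y) : ℕ → Set X → Prop
  | 0, Z => Z.Nonempty
  | k + 1, Z => ∃ b ∈ B, treeRank χ B k (Z ∩ {x | χ x b}) ∧ treeRank χ B k (Z ∩ {x | ¬ χ x b})

variable {χ : X → Y → Prop}

theorem treeRank_mono {B B' : Set Y} (hB : B ⊆ B') {k : ℕ} {Z Z' : Set X} (hZ : Z ⊆ Z')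
    (h : treeRank χ B k Z) : treeRank χ B' k Z' := by
  induction k generalizing Z Z' with
  | zero => exact Set.Nonempty.mono hZ h
  | succ k ih =>
    obtain ⟨b, hb, h1, h2⟩ := h
    exact ⟨b, hB hb, ih (inter_subset_inter_left _ hZ) h1, ih (inter_subset_inter_left _ hZ) h2⟩

theorem treeRank.nonempty {B : Set Y} {k : ℕ} {Z : Set X} (h : treeRank χ B k Z) : Z.Nonempty := by
  induction k generalizing Z with
  | zero => exact h
  | succ k ih =>
    obtain ⟨b, -, h1, -⟩ := h
    exact (ih h1).mono inter_subset_left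

/-- If the parameters of a tree are split into two parts, then one of the parts carries a large
subtree. -/
theorem treeRank_partition {B N N' : Set Y} (hB : B ⊆ N ∪ N') (m n : ℕ) {Z : Set X}
    (h : treeRank χ B (m + n) Z) : treeRank χ N m Z ∨ treeRank χ N' n Z := by
  induction hk : m + n generalizing m n Z with
  | zero =>
    obtain ⟨rfl, rfl⟩ : m = 0 ∧ n = 0 := by omega
    exact Or.inl h
  | succ k ih =>
    rcases m with _ | m
    · exact Or.inl h.nonempty
    rcases n with _ | n
    · exact Or.inr h.nonempty
    rw [hk] at h
    obtain ⟨b, hb, h1, h2⟩ := h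
    -- The root lies in one part, say `N`. Either both subtrees yield height `m` over `N`, and the
    -- root joins them, or one of them already yields the full height over `N'`.
    rcases hB hb with hb | hb
    · have e : k = m + (n + 1) := by omega
      rw [e] at h1 h2
      rcases ih m (n + 1) h1 e.symm with h1 | h1
      · rcases ih m (n + 1) h2 e.symm with h2 | h2
        · exact Or.inl ⟨b, hb, h1, h2⟩
        · exact Or.inr (treeRank_mono subset_rfl inter_subset_left h2)
      · exact Or.inr (treeRank_mono subset_rfl inter_subset_left h1)
    · have e : k = (m + 1) + n := by omega
      rw [e] at h1 h2
      rcases ih (m + 1) n h1 e.symm with h1 | h1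
      · exact Or.inl (treeRank_mono subset_rfl inter_subset_left h1)
      · rcases ih (m + 1) n h2 e.symm with h2 | h2
        · exact Or.inl (treeRank_mono subset_rfl inter_subset_left h2)
        · exact Or.inr ⟨b, hb, h1, h2⟩

/-- The height of a tree that suffices for a ladder of length `n`. -/
def ladderBound : ℕ → ℕ
  | 0 => 0
  | n + 1 => 2 * (ladderBound n + 1)

/-- High trees yield long ladders. -/
theorem exists_ladder_of_treeRank [Nonempty X] [Nonempty Y] (n : ℕ) {B : Set Y} {Z : Set X}
    (h : treeRank χ B (ladderBound n) Z) :
    ∃ (a : ℕ → X) (b : ℕ → Y), (∀ i < n, a i ∈ Z) ∧ (∀ i < n, b i ∈ B) ∧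
      ∀ i < n, ∀ j < n, χ (a i) (b j) ↔ i ≤ j := by
  induction n generalizing B Z with
  | zero =>
    exact ⟨fun _ => Classical.arbitrary X, fun _ => Classical.arbitrary Y, by simp, by simp, by simp⟩
  | succ n ih =>
    -- If the parameters true at some `a` still carry a tall tree, put `a` and the root `b` at the
    -- bottom of the ladder and continue on the branch where `χ x b` fails.
    by_cases hc : ∃ a ∈ Z, treeRank χ (B ∩ {y | χ a y}) (ladderBound n + 1) Z
    · obtain ⟨a, ha, b, ⟨hbB, hab⟩, -, h2⟩ := hc
      obtain ⟨a', b', ha', hb', hl⟩ := ih h2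
      refine ⟨fun i => Nat.casesOn i a a', fun i => Nat.casesOn i b b', ?_, ?_, ?_⟩
      · rintro (_ | i) hi
        · exact ha
        · exact (ha' i (by omega)).1
      · rintro (_ | i) hi
        · exact hbB
        · exact (hb' i (by omega)).1
      · rintro (_ | i) hi (_ | j) hj
        · exact iff_of_true hab le_rfl
        · exact iff_of_true (hb' j (by omega)).2 (Nat.zero_le _)
        · exact iff_of_false (ha' i (by omega)).2 (by omega)
        · exact (hl i (by omega) j (by omega)).trans (by omega)
    -- Otherwise take `a` on the positive branch of the root `b`. By partition the parameters false
    -- at `a` carry a tree of height `ladderBound n` on that branch, so `a` and `b` go at the top of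
    -- the ladder.
    · have e : ladderBound (n + 1) = (ladderBound n + 1 + ladderBound n) + 1 := by
        simp only [ladderBound]; omega
      rw [e] at h
      obtain ⟨b, hb, h1, -⟩ := h
      obtain ⟨a, haZ, hab⟩ := h1.nonempty
      have hB : B ⊆ (B ∩ {y | χ a y}) ∪ (B ∩ {y | ¬ χ a y}) := by
        intro y hy
        by_cases hay : χ a y
        · exact Or.inl ⟨hy, hay⟩
        · exact Or.inr ⟨hy, hay⟩
      rcases treeRank_partition hB _ _ h1 with h1 | h1
      · exact (hc ⟨a, haZ, treeRank_mono subset_rfl inter_subset_left h1⟩).elim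
      obtain ⟨a', b', ha', hb', hl⟩ := ih h1
      refine ⟨fun i => if i = n then a else a' i, fun i => if i = n then b else b' i, ?_, ?_, ?_⟩
      · intro i hi
        by_cases hin : i = n
        · simpa [hin] using haZ
        · simpa [hin] using (ha' i (by omega)).1
      · intro i hi
        by_cases hin : i = n
        · simpa [hin] using hb
        · simpa [hin] using (hb' i (by omega)).1
      · intro i hi j hj
        by_cases hin : i = n <;> by_cases hjn : j = n
        · simpa [hin, hjn] using hab
        · simp only [hin, hjn, if_true, if_false]
          exact iff_of_false (hb' j (by omega)).2 (by omega)
        · simp only [hin, hjn, if_true, if_false]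
          exact iff_of_true (ha' i (by omega)).2 (by omega)
        · simp only [hin, hjn, if_false]
          exact hl i (by omega) j (by omega)

/-- In a family of nonempty sets, if the ranks are bounded, some member has minimal rank. -/
theorem exists_minimal_treeRank {B : Set Y} {𝓩 : Set (Set X)} (hne : ∀ Z ∈ 𝓩, Z.Nonempty)
    (h𝓩 : 𝓩.Nonempty) (hb : ∃ k, ¬ treeRank χ B k univ) :
    ∃ k, ∃ Z ∈ 𝓩, ¬ treeRank χ B (k + 1) Z ∧ ∀ Z' ∈ 𝓩, treeRank χ B k Z' := by
  classical
  have hex : ∃ k, ∃ Z ∈ 𝓩, ¬ treeRank χ B k Z := by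
    obtain ⟨k, hk⟩ := hb
    obtain ⟨Z, hZ⟩ := h𝓩
    exact ⟨k, Z, hZ, fun h => hk (treeRank_mono subset_rfl (subset_univ _) h)⟩
  obtain ⟨Z, hZ, hk⟩ := Nat.find_spec hex
  rcases hf : Nat.find hex with _ | k
  · rw [hf] at hk
    exact (hk (hne Z hZ)).elim
  · rw [hf] at hk
    refine ⟨k, Z, hZ, hk, fun Z' hZ' => ?_⟩
    by_contra hcon
    exact Nat.find_min hex (m := k) (by omega) ⟨Z', hZ', hcon⟩

end TreeRank

/-! ### Ultrapowers, and bounded rank in stable theories -/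

section Stable

open Filter

variable {L : FirstOrder.Language.{u, v}}

/-- The ultrapower of a structure. -/
abbrev Ultrapower {Ω : Type w} (U : Ultrafilter Ω) (M : Type w) : Type w :=
  (U : Filter Ω).Product (fun _ => M)

/-- The class of a function in the ultrapower. -/
def ultraMk {Ω : Type w} (U : Ultrafilter Ω) {M : Type w} (f : Ω → M) : Ultrapower U M :=
  (f : (U : Filter Ω).Product (fun _ => M))

section Ultrapower

variable {Ω M : Type w} {U : Ultrafilter Ω} [L.Structure M] [Nonempty M]

theorem ultraMk_surjective {M : Type w} : Function.Surjective (ultraMk U (M := M)) :=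
  @Quotient.mk'_surjective _ ((U : Filter Ω).productSetoid fun _ => M)

theorem ultraMk_eq_iff {M : Type w} {f g : Ω → M} :
    ultraMk U f = ultraMk U g ↔ ∀ᶠ v in U, f v = g v :=
  Quotient.eq''

theorem realize_ultraMk {α : Type*} (φ : L.Formula α) (x : α → Ω → M) (y : α → Ultrapower U M)
    (hxy : ∀ i, y i = ultraMk U (x i)) :
    φ.Realize y ↔ ∀ᶠ v in U, φ.Realize (fun i => x i v) := by
  rw [show y = fun i => ultraMk U (x i) from funext hxy]
  exact Ultraproduct.realize_formula_cast φ x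

instance ultrapower_models (T : L.Theory) [M ⊨ T] : Ultrapower U M ⊨ T :=
  ⟨fun σ hσ => (Ultraproduct.sentence_realize σ).2
    (Eventually.of_forall fun _ => Theory.realize_sentence_of_mem T hσ)⟩

theorem ultraMk_mem_predSet {P : L.Relations 1} {f : Ω → M} :
    ultraMk U f ∈ predSet P (Ultrapower U M) ↔ ∀ᶠ v in U, f v ∈ predSet P M := by
  have := realize_ultraMk (U := U) (P.formula Term.var : L.Formula (Fin 1)) (fun _ => f)
    ![ultraMk U f] (fun i => by rw [Subsingleton.elim i 0]; rfl)
  simpa only [predSet, mem_ofPred_eq, Formula.realize_rel, Term.realize_var,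
    Matrix.vec_single_eq_const] using this

/-- The diagonal embedding of a structure into its ultrapower. -/
def ultraDiag (L : FirstOrder.Language.{u, v}) [L.Structure M] (U : Ultrafilter Ω) :
    M ↪ₑ[L] Ultrapower U M where
  toFun a := ultraMk U fun _ => a
  map_formula' n φ x := by
    exact (realize_ultraMk φ (fun i _ => x i) _ (fun i => rfl)).trans eventually_const

end Ultrapower

/-- Unbounded tree heights give ladders of every finite length, and an ultrapower glues these into
an infinite one, which is the order property. -/
theorem exists_not_treeRank_of_isStable {T : L.Theory} (hT : IsStable.{u, v, w} T)
    (M : Type w) [L.Structure M] [M ⊨ T] [Nonempty M] {m n : ℕ} (φ : L.Formula (Fin m ⊕ Fin n)) :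
    ∃ k, ¬ treeRank (fun (x : Fin m → M) (y : Fin n → M) => φ.Realize (Sum.elim x y)) univ k
      univ := by
  by_contra! hcon
  have hlad := fun l => exists_ladder_of_treeRank l (hcon (ladderBound l))
  choose a b _ _ hab using hlad
  let U : Ultrafilter (ULift.{w} ℕ) := Ultrafilter.map ULift.up (hyperfilter ℕ)
  -- The shift `i + 1` turns the ladder condition `i + 1 ≤ j` into the strict order that `IsStable`
  -- forbids.
  refine hT m n φ (Ultrapower U M) ⟨fun i q => ultraMk U fun l => a l.down (i + 1) q,
    fun j q => ultraMk U fun l => b l.down j q, fun i j => ?_⟩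
  rw [realize_ultraMk φ (Sum.elim (fun q l => a l.down (i + 1) q) (fun q l => b l.down j q)) _
    (by rintro (q | q) <;> rfl)]
  have e2 : ∀ l : ULift.{w} ℕ, (fun q => Sum.elim (fun q (l : ULift.{w} ℕ) => a l.down (i + 1) q)
      (fun q l => b l.down j q) q l) = Sum.elim (a l.down (i + 1)) (b l.down j) := by
    intro l
    ext (q | q) <;> rfl
  simp only [e2]
  have hev : ∀ᶠ l in (hyperfilter ℕ : Filter ℕ), i + 1 < l ∧ j < l := by
    have : ∀ᶠ l in (atTop : Filter ℕ), i + 1 < l ∧ j < l :=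
      (eventually_gt_atTop _).and (eventually_gt_atTop _)
    rw [← Nat.cofinite_eq_atTop] at this
    exact hyperfilter_le_cofinite this
  have hev' : ∀ᶠ l in (U : Filter (ULift.{w} ℕ)), i + 1 < l.down ∧ j < l.down := hev
  rw [eventually_congr (hev'.mono fun l hl => hab l.down (i + 1) hl.1 j hl.2)]
  simp

theorem exists_fin_formula {α : Type*} (φ : L.Formula α) :
    ∃ (n : ℕ) (ψ : L.Formula (Fin n)) (d : Fin n → α),
      ∀ (M : Type w) [L.Structure M] (v : α → M), φ.Realize v ↔ ψ.Realize (v ∘ d) := by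
  classical
  let e := φ.freeVarFinset.equivFin
  refine ⟨_, (φ.restrictFreeVar e : L.Formula _), fun i => (e.symm i : α), fun M _ v => ?_⟩
  exact (BoundedFormula.realize_restrictFreeVar v (by simp)).symm

end Stable

/-! ### Locally isolated types -/

section LocalIsolation

variable {L : FirstOrder.Language.{u, v}}

/-- Only finitely many parameters occur in a formula. Splitting them off exhibits it as an instance
of one of the countably many parameter-free formulas. -/
theorem exists_fin_split {α β : Type*} (φ : L.Formula (β ⊕ α)) :
    ∃ (n : ℕ) (ψ : L.Formula (β ⊕ Fin n)) (d : Fin n → α),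
      ∀ (M : Type w) [L.Structure M] (x : β → M) (v : α → M),
        φ.Realize (Sum.elim x v) ↔ ψ.Realize (Sum.elim x (v ∘ d)) := by
  classical
  let s := φ.freeVarFinset.toRight
  let e := s.equivFin
  let f : φ.freeVarFinset → β ⊕ Fin s.card := fun z => match z with
    | ⟨Sum.inl b, _⟩ => Sum.inl b
    | ⟨Sum.inr a, h⟩ => Sum.inr (e ⟨a, Finset.mem_toRight.2 h⟩)
  refine ⟨s.card, (φ.restrictFreeVar f : L.Formula _), fun i => (e.symm i : α), fun M _ x v => ?_⟩
  refine (BoundedFormula.realize_restrictFreeVar (Sum.elim x v) ?_).symm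
  rintro ⟨b | a, h⟩ <;> simp [f]

theorem countable_formula (hL : L.card ≤ Cardinal.aleph0) (α : Type) [Countable α] :
    Countable (L.Formula α) := by
  have h := BoundedFormula.card_le (L := L) (α := α)
  have h2 : Cardinal.mk (Σ n, L.BoundedFormula α n) ≤ Cardinal.aleph0 := by
    refine h.trans (max_le le_rfl (Cardinal.add_le_aleph0.2 ⟨?_, ?_⟩))
    · exact Cardinal.lift_le_aleph0.2 Cardinal.mk_le_aleph0
    · exact Cardinal.lift_le_aleph0.2 hL
  have : Countable (Σ n, L.BoundedFormula α n) := Cardinal.mk_le_aleph0_iff.1 h2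
  exact Function.Injective.countable (f := fun φ : L.Formula α =>
    (⟨0, φ⟩ : Σ n, L.BoundedFormula α n)) (fun φ ψ h => by simpa using h)

variable {T : L.Theory} (hT : IsStable.{u, v, w} T) {C : Type w} [L.Structure C] [C ⊨ T]
  [Nonempty C] {δ : Type*} (e : δ → C)

include hT in
-- Take a consistent strengthening of `θ` of minimal rank for `χ`. If some instance of `χ` and its
-- negation were both consistent with it, both halves would again have rank at least `k`, and the
-- instance would be the root of a tree of height `k + 1`. The minimum does not depend on the
-- instance, so one `g` serves all `d`.
theorem exists_deciding_formula (θ : L.Formula (Fin 1 ⊕ δ)) (hθ : ∃ x, θ.Realize (Sum.elim x e))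
    {n : ℕ} (χ : L.Formula (Fin 1 ⊕ Fin n)) :
    ∃ g : L.Formula (Fin 1 ⊕ δ), (∃ x, (θ ⊓ g).Realize (Sum.elim x e)) ∧ ∀ d : Fin n → δ,
      (∀ x, (θ ⊓ g).Realize (Sum.elim x e) → χ.Realize (Sum.elim x (e ∘ d))) ∨
      (∀ x, (θ ⊓ g).Realize (Sum.elim x e) → ¬ χ.Realize (Sum.elim x (e ∘ d))) := by
  let 𝓩 : Set (Set (Fin 1 → C)) := {Z | Z.Nonempty ∧ ∃ g : L.Formula (Fin 1 ⊕ δ),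
    Z = {x | (θ ⊓ g).Realize (Sum.elim x e)}}
  obtain ⟨k, _, ⟨hne, g, rfl⟩, hk, hmin⟩ := exists_minimal_treeRank (𝓩 := 𝓩) (fun Z hZ => hZ.1)
    ⟨{x | (θ ⊓ ⊤).Realize (Sum.elim x e)}, by simpa [Set.Nonempty] using hθ, ⊤, rfl⟩
    (exists_not_treeRank_of_isStable hT C χ)
  refine ⟨g, hne, fun d => ?_⟩
  by_contra! hcon
  obtain ⟨⟨x, hx, hxχ⟩, y, hy, hyχ⟩ := hcon
  refine hk ⟨e ∘ d, mem_univ _, hmin _ ⟨⟨y, hy, hyχ⟩, g ⊓ χ.relabel (Sum.map id d), ?_⟩,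
    hmin _ ⟨⟨x, hx, hxχ⟩, g ⊓ (χ.relabel (Sum.map id d)).not, ?_⟩⟩
  all_goals
    ext z
    simp [Sum.elim_comp_map, and_assoc]

include hT in
/-- Over any set, every consistent formula extends to a locally isolated type. -/
theorem exists_locally_isolated (hL : L.card ≤ Cardinal.aleph0) (θ : L.Formula (Fin 1 ⊕ δ))
    (hθ : ∃ x, θ.Realize (Sum.elim x e)) :
    ∃ γ : ℕ → L.Formula (Fin 1 ⊕ δ), γ 0 = θ ∧ (∀ k, ∃ g, γ (k + 1) = γ k ⊓ g) ∧
      (∀ k, ∃ x, (γ k).Realize (Sum.elim x e)) ∧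
      ∀ (β : Type) [Finite β] (χ : L.Formula (Fin 1 ⊕ β)), ∃ k, ∀ d : β → δ,
        (∀ x, (γ k).Realize (Sum.elim x e) → χ.Realize (Sum.elim x (e ∘ d))) ∨
        (∀ x, (γ k).Realize (Sum.elim x e) → ¬ χ.Realize (Sum.elim x (e ∘ d))) := by
  have hcount : ∀ n, Countable (L.Formula (Fin 1 ⊕ Fin n)) := fun n => countable_formula hL _
  have : Nonempty (Σ n, L.Formula (Fin 1 ⊕ Fin n)) := ⟨⟨0, ⊤⟩⟩
  obtain ⟨enum, henum⟩ := exists_surjective_nat (Σ n, L.Formula (Fin 1 ⊕ Fin n))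
  choose! g hg hdec using fun (θ : L.Formula (Fin 1 ⊕ δ))
    (χ : Σ n, L.Formula (Fin 1 ⊕ Fin n)) (hθ : ∃ x, θ.Realize (Sum.elim x e)) =>
      exists_deciding_formula hT e θ hθ χ.2
  let γ : ℕ → L.Formula (Fin 1 ⊕ δ) := fun k => Nat.rec θ (fun k ρ => ρ ⊓ g ρ (enum k)) k
  have hγ : ∀ k, ∃ x, (γ k).Realize (Sum.elim x e) := by
    intro k
    induction k with
    | zero => exact hθ
    | succ k ih => exact hg _ _ ih
  refine ⟨γ, rfl, fun k => ⟨_, rfl⟩, hγ, fun β _ χ => ?_⟩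
  obtain ⟨n, ⟨f⟩⟩ := Finite.exists_equiv_fin β
  obtain ⟨k, hk⟩ := henum ⟨n, χ.relabel (Sum.map id f)⟩
  refine ⟨k + 1, fun d => ?_⟩
  have h := hdec (γ k) (enum k) (hγ k)
  rw [hk] at h
  have h' := h (d ∘ f.symm)
  have e1 : (e ∘ d ∘ f.symm) ∘ f = e ∘ d := by ext; simp
  simp only [Formula.realize_relabel, Sum.elim_comp_map, Function.comp_id, e1] at h'
  have hγk : γ (k + 1) = γ k ⊓ g (γ k) (enum k) := rfl
  rw [hγk, hk]
  exact h'

end LocalIsolation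

/-! ### Construction of a model with prescribed `P`-part -/

section Existence

open Filter

variable {L : FirstOrder.Language.{u, v}}

theorem realize_iAlls_swap {α β : Type*} [Finite β] {M : Type*} [L.Structure M]
    {φ : L.Formula (β ⊕ α)} {v : α → M} :
    ((φ.relabel Sum.swap).iAlls β).Realize v ↔ ∀ x, φ.Realize (Sum.elim x v) := by
  rw [Formula.realize_iAlls]
  refine forall_congr' fun x => ?_
  rw [Formula.realize_relabel]
  have : (fun a => Sum.elim v x a) ∘ Sum.swap = Sum.elim x v := by ext (a | a) <;> rfl
  rw [this]

theorem realize_iExs_swap {α β : Type*} [Finite β] {M : Type*} [L.Structure M]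
    {φ : L.Formula (β ⊕ α)} {v : α → M} :
    ((φ.relabel Sum.swap).iExs β).Realize v ↔ ∃ x, φ.Realize (Sum.elim x v) := by
  rw [Formula.realize_iExs]
  refine exists_congr fun x => ?_
  rw [Formula.realize_relabel]
  have : Sum.elim v x ∘ Sum.swap = Sum.elim x v := by ext (a | a) <;> rfl
  rw [this]

/-- Names for the elements of a model that is generated by `A` and by witnesses for formulas; the
formulas are coded by natural numbers. -/
inductive Henkin (A : Type w) : Type w
  | base : A → Henkin A
  | wit (k n : ℕ) : (Fin n → Henkin A) → Henkin A

/-- A complete subset of an ultrapower of `M` with the same `P`-part as `A`: the elements are named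
by `D`, and their type over `A` is given by the filter `F`. -/
structure IsCompleteDiagram (P : L.Relations 1) {M : Type w} [L.Structure M] (A : Set M)
    (form : ∀ n, ℕ → L.Formula (Fin n ⊕ Fin 1)) (D : Set (Henkin A)) (F : Filter (Henkin A → M)) :
    Prop where
  neBot : F.NeBot
  -- The filter has a base of sets that depend only on the coordinates in `D`, so the value at a
  -- name outside `D` can be changed freely.
  saturated : ∀ S ∈ F, ∃ S' ∈ F, S' ⊆ S ∧ ∀ v ∈ S', ∀ v', (∀ x ∈ D, v' x = v x) → v' ∈ S'
  base_mem : ∀ a : A, Henkin.base a ∈ D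
  base_eq : ∀ a : A, ∀ᶠ v in F, v (Henkin.base a) = (a : M)
  decides : ∀ (n : ℕ) (φ : L.Formula (Fin n)) (d : Fin n → Henkin A), (∀ i, d i ∈ D) →
    (∀ᶠ v in F, φ.Realize (v ∘ d)) ∨ ∀ᶠ v in F, ¬ φ.Realize (v ∘ d)
  -- The hypothesis is "frequently" because that passes from a smaller filter to a larger one, as
  -- needed at extensions and unions; the conclusion is "eventually", which passes the other way.
  complete : ∀ (m n : ℕ) (ψ : L.Formula (Fin m ⊕ Fin n)) (b : Fin n → Henkin A), (∀ i, b i ∈ D) →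
    (∃ᶠ v in F, ∃ a : Fin m → M, (∀ i, a i ∈ predSet P M) ∧ ψ.Realize (Sum.elim a (v ∘ b))) →
    ∃ a : Fin m → Henkin A, (∀ i, a i ∈ D) ∧
      ∀ᶠ v in F, (∀ i, v (a i) ∈ predSet P M) ∧ ψ.Realize (Sum.elim (v ∘ a) (v ∘ b))
  pred_eq : ∀ x ∈ D, (∃ᶠ v in F, v x ∈ predSet P M) → ∃ a : A, ∀ᶠ v in F, v x = (a : M)
  henkin : ∀ k n args, Henkin.wit k n args ∈ D → ∀ᶠ v in F,
    (∃ x, (form n k).Realize (Sum.elim (v ∘ args) x)) →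
      (form n k).Realize (Sum.elim (v ∘ args) fun _ => v (Henkin.wit k n args))

/-- The filter of an extension of the type given by `F` by a type in the variable `c` that is
generated by a decreasing sequence of conditions. -/
def extendFilter {X : Type*} {M : Type*} [DecidableEq X] (F : Filter (X → M)) (c : X)
    (Γ : ℕ → (X → M) → M → Prop) (hΓ : Antitone Γ) : Filter (X → M) where
  sets := {S | ∃ k, ∀ᶠ v in F, ∀ y, Γ k v y → Function.update v c y ∈ S}
  univ_sets := ⟨0, by simp⟩
  sets_of_superset := by
    rintro S S' ⟨k, hk⟩ hS
    exact ⟨k, hk.mono fun v hv y hy => hS (hv y hy)⟩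
  inter_sets := by
    rintro S S' ⟨k, hk⟩ ⟨l, hl⟩
    refine ⟨max k l, (hk.and hl).mono fun v hv y hy => ⟨hv.1 y ?_, hv.2 y ?_⟩⟩
    · exact hΓ (le_max_left k l) v y hy
    · exact hΓ (le_max_right k l) v y hy

theorem eventually_extendFilter {X : Type*} {M : Type*} [DecidableEq X] {F : Filter (X → M)} {c : X}
    {Γ : ℕ → (X → M) → M → Prop} {hΓ : Antitone Γ} {p : (X → M) → Prop} :
    (∀ᶠ v in extendFilter F c Γ hΓ, p v) ↔
      ∃ k, ∀ᶠ v in F, ∀ y, Γ k v y → p (Function.update v c y) :=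
  Iff.rfl

theorem frequently_extendFilter {X : Type*} {M : Type*} [DecidableEq X] {F : Filter (X → M)} {c : X}
    {Γ : ℕ → (X → M) → M → Prop} {hΓ : Antitone Γ} {p : (X → M) → Prop} :
    (∃ᶠ v in extendFilter F c Γ hΓ, p v) ↔
      ∀ k, ∃ᶠ v in F, ∃ y, Γ k v y ∧ p (Function.update v c y) := by
  simp only [Filter.Frequently, eventually_extendFilter]
  push Not
  rfl

namespace IsCompleteDiagram

variable {P : L.Relations 1} {M : Type w} [L.Structure M] {A : Set M}
  {form : ∀ n, ℕ → L.Formula (Fin n ⊕ Fin 1)} {D : Set (Henkin A)} {F : Filter (Henkin A → M)}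

theorem decides_formula (h : IsCompleteDiagram P A form D F) (φ : L.Formula D) :
    (∀ᶠ v in F, φ.Realize (fun x : D => v x)) ∨ ∀ᶠ v in F, ¬ φ.Realize (fun x : D => v x) := by
  obtain ⟨n, ψ, d, hd⟩ := exists_fin_formula.{u, v, w} φ
  simp only [hd]
  exact h.decides n ψ (fun i => d i) (fun i => (d i).2)

theorem complete_formula (h : IsCompleteDiagram P A form D F) {m : ℕ} (ψ : L.Formula (Fin m ⊕ D))
    (hψ : ∃ᶠ v in F, ∃ a : Fin m → M, (∀ i, a i ∈ predSet P M) ∧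
      ψ.Realize (Sum.elim a (fun x : D => v x))) :
    ∃ a : Fin m → D, ∀ᶠ v in F, (∀ i, v (a i) ∈ predSet P M) ∧
      ψ.Realize (Sum.elim (fun i => v (a i)) (fun x : D => v x)) := by
  obtain ⟨n, ψ', d, hd⟩ := exists_fin_split.{u, v, w} ψ
  simp only [hd] at hψ ⊢
  obtain ⟨a, ha, h'⟩ := h.complete m n ψ' (fun i => d i) (fun i => (d i).2) hψ
  exact ⟨fun i => ⟨a i, ha i⟩, h'⟩

variable [Nonempty M]

/-- The filter decides every formula with parameters in `D`, so every finer ultrafilter gives these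
names the same type. -/
theorem realize_ultrapower (h : IsCompleteDiagram P A form D F) {U : Ultrafilter (Henkin A → M)}
    (hU : (U : Filter (Henkin A → M)) ≤ F) (φ : L.Formula D) :
    φ.Realize (fun x : D => ultraMk U fun v => v x) ↔ ∀ᶠ v in F, φ.Realize (fun x : D => v x) := by
  refine (realize_ultraMk (U := U) φ (fun (x : D) (v : Henkin A → M) => v x) _
    (fun _ => rfl)).trans ⟨fun hφ => (h.decides_formula φ).resolve_right fun hn => ?_, fun hφ => hφ.filter_mono hU⟩
  obtain ⟨v, hv, hv'⟩ := (hφ.and (hn.filter_mono hU)).exists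
  exact hv' hv

theorem forall_realize_ultrapower (h : IsCompleteDiagram P A form D F)
    {U : Ultrafilter (Henkin A → M)} (hU : (U : Filter (Henkin A → M)) ≤ F)
    (φ : L.Formula (Fin 1 ⊕ D)) :
    (∀ x, φ.Realize (Sum.elim x (fun x : D => ultraMk U fun v => v x))) ↔
      ∀ᶠ v in F, ∀ x, φ.Realize (Sum.elim x (fun x : D => v x)) := by
  simpa only [realize_iAlls_swap] using
    h.realize_ultrapower hU ((φ.relabel Sum.swap).iAlls (Fin 1))

theorem exists_realize_ultrapower (h : IsCompleteDiagram P A form D F)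
    {U : Ultrafilter (Henkin A → M)} (hU : (U : Filter (Henkin A → M)) ≤ F)
    (φ : L.Formula (Fin 1 ⊕ D)) :
    (∃ x, φ.Realize (Sum.elim x (fun x : D => ultraMk U fun v => v x))) ↔
      ∀ᶠ v in F, ∃ x, φ.Realize (Sum.elim x (fun x : D => v x)) := by
  simpa only [realize_iExs_swap] using
    h.realize_ultrapower hU ((φ.relabel Sum.swap).iExs (Fin 1))

variable {T : L.Theory} [M ⊨ T]

/-- One more element can be added to a complete diagram. -/
theorem exists_extend (h : IsCompleteDiagram P A form D F) (hL : L.card ≤ Cardinal.aleph0)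
    (hT : IsStable.{u, v, w} T) {k₀ n₀ : ℕ} {args : Fin n₀ → Henkin A} (hargs : ∀ i, args i ∈ D)
    (hc : Henkin.wit k₀ n₀ args ∉ D) :
    ∃ F' ≤ F, IsCompleteDiagram P A form (insert (Henkin.wit k₀ n₀ args) D) F' := by
  classical
  have := h.neBot
  set c := Henkin.wit k₀ n₀ args with hcdef
  let U : Ultrafilter (Henkin A → M) := Ultrafilter.of F
  have hU : (U : Filter (Henkin A → M)) ≤ F := Ultrafilter.of_le F
  let e : D → Ultrapower U M := fun x => ultraMk U fun v => v x
  let f₀ : L.Formula (Fin 1 ⊕ D) :=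
    (form n₀ k₀).relabel (Sum.elim (fun i => Sum.inr ⟨args i, hargs i⟩) Sum.inl)
  -- The Henkin axiom for the new name: if the coded formula has a solution, then the new element is
  -- one. It is consistent in any case.
  let θ : L.Formula (Fin 1 ⊕ D) :=
    Formula.imp (((f₀.relabel Sum.swap).iExs (Fin 1)).relabel Sum.inr) f₀
  have hf₀ : ∀ (v : Henkin A → M) (x : Fin 1 → M),
      f₀.Realize (Sum.elim x fun z : D => v z) ↔ (form n₀ k₀).Realize (Sum.elim (v ∘ args) x) := by
    intro v x
    rw [Formula.realize_relabel]
    have : (Sum.elim x fun z : D => v z) ∘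
        (Sum.elim (fun i => Sum.inr ⟨args i, hargs i⟩) Sum.inl) = Sum.elim (v ∘ args) x := by
      ext (i | i) <;> rfl
    rw [this]
  have hθ' : ∀ (N : Type w) [L.Structure N] (v : D → N) (x : Fin 1 → N),
      θ.Realize (Sum.elim x v) ↔
        ((∃ x, f₀.Realize (Sum.elim x v)) → f₀.Realize (Sum.elim x v)) := by
    intro N _ v x
    simp only [θ, Formula.realize_imp, Formula.realize_relabel, Sum.elim_comp_inr,
      realize_iExs_swap]
  have hθ : ∃ x, θ.Realize (Sum.elim x e) := by
    simp only [hθ']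
    by_cases hex : ∃ x, f₀.Realize (Sum.elim x e)
    · obtain ⟨x, hx⟩ := hex
      exact ⟨x, fun _ => hx⟩
    · exact ⟨fun _ => Classical.arbitrary _, fun hx => (hex hx).elim⟩
  obtain ⟨γ, hγ0, hγs, hγne, hγdec⟩ := exists_locally_isolated hT e hL θ hθ
  let Γ : ℕ → (Henkin A → M) → M → Prop := fun k v y =>
    (γ k).Realize (Sum.elim (fun _ => y) (fun z : D => v z))
  have hΓ : Antitone Γ := by
    refine antitone_nat_of_succ_le fun k v y hy => ?_
    obtain ⟨g, hg⟩ := hγs k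
    simp only [Γ, hg, Formula.realize_inf] at hy
    exact hy.1
  let F' := extendFilter F c Γ hΓ
  have hupd : ∀ (v : Henkin A → M) y, ∀ z ∈ D, Function.update v c y z = v z := by
    intro v y z hz
    exact Function.update_of_ne (fun hzc : z = c => hc (hzc ▸ hz)) _ _
  have hupd' : ∀ (v : Henkin A → M) y,
      (fun z : D => Function.update v c y z) = fun z : D => v z :=
    fun v y => funext fun z => hupd v y z z.2
  -- Updating the value at `c` leaves the coordinates in `D` alone, so saturation of `F` applies.
  have hle : F' ≤ F := by
    intro S hS
    obtain ⟨S', hS', hsub, hsat⟩ := h.saturated S hS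
    exact ⟨0, mem_of_superset hS' fun v hv y _ => hsub (hsat v hv _ (hupd v y))⟩
  have hF'ne : F'.NeBot := by
    rw [neBot_iff]
    intro hbot
    have hev : ∀ᶠ v in F', False := by rw [hbot]; exact eventually_bot
    obtain ⟨k, hk⟩ := eventually_extendFilter.1 hev
    have hex := (h.exists_realize_ultrapower hU (γ k)).1 (hγne k)
    obtain ⟨v, hv, x, hx⟩ := (hk.and hex).exists
    refine hv (x 0) ?_
    simp only [Γ]
    convert hx using 2
    ext i
    rw [Subsingleton.elim i 0]
  -- Whatever some `γ k` implies in the ultrapower becomes true of the new element.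
  have key : ∀ (φ : L.Formula (Fin 1 ⊕ D)),
      (∃ k, ∀ x, (γ k).Realize (Sum.elim x e) → φ.Realize (Sum.elim x e)) →
      ∀ᶠ w in F', φ.Realize (Sum.elim (fun _ => w c) (fun z : D => w z)) := by
    rintro φ ⟨k, hk⟩
    have := (h.forall_realize_ultrapower hU ((γ k).imp φ)).1
      (fun x => Formula.realize_imp.2 (hk x))
    refine eventually_extendFilter.2 ⟨k, this.mono fun v hv y hy => ?_⟩
    have h2 := Formula.realize_imp.1 (hv fun _ => y) hy
    simpa only [hupd', Function.update_self] using h2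
  have hθc : ∀ᶠ w in F', θ.Realize (Sum.elim (fun _ => w c) (fun z : D => w z)) :=
    key θ ⟨0, fun x hx => hγ0 ▸ hx⟩
  refine ⟨F', hle, hF'ne, ?_, fun a => Or.inr (h.base_mem a), fun a => hle (h.base_eq a), ?_, ?_,
    ?_, ?_⟩
  · rintro S ⟨k, hk⟩
    obtain ⟨S', hS', hsub, hsat⟩ := h.saturated _ hk
    refine ⟨{w | w ∈ S' ∧ Γ k w (w c)}, ?_, ?_, ?_⟩
    · refine ⟨k, mem_of_superset hS' fun v hv y hy => ⟨hsat v hv _ (hupd v y), ?_⟩⟩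
      simpa only [Γ, hupd', Function.update_self] using hy
    · rintro w ⟨hw, hwc⟩
      simpa using hsub hw (w c) hwc
    · rintro w ⟨hw, hwc⟩ w' hw'
      refine ⟨hsat w hw w' fun x hx => hw' x (Or.inr hx), ?_⟩
      have e1 : (fun z : D => w' z) = fun z : D => w z := funext fun z => hw' z (Or.inr z.2)
      simpa only [Γ, e1, hw' c (Or.inl rfl)] using hwc
  · intro n φ d hd
    let φ' : L.Formula (Fin 1 ⊕ D) := φ.relabel fun i =>
      if hi : d i = c then Sum.inl 0 else Sum.inr ⟨d i, (hd i).resolve_left hi⟩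
    have hφ' : ∀ w : Henkin A → M,
        φ'.Realize (Sum.elim (fun _ => w c) (fun z : D => w z)) ↔ φ.Realize (w ∘ d) := by
      intro w
      rw [Formula.realize_relabel]
      refine iff_of_eq (congrArg _ (funext fun i => ?_))
      by_cases hi : d i = c <;> simp [hi]
    obtain ⟨n', χ, d', hχ⟩ := exists_fin_split.{u, v, w} φ'
    obtain ⟨k, hk⟩ := hγdec (Fin n') χ
    simp only [← hφ']
    rcases hk d' with hk | hk
    · exact Or.inl (key φ' ⟨k, fun x hx => (hχ _ x e).2 (hk x hx)⟩)
    · refine Or.inr ?_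
      have := key φ'.not ⟨k, fun x hx => Formula.realize_not.2 fun h' => hk x hx ((hχ _ x e).1 h')⟩
      simpa only [Formula.realize_not] using this
  · intro m n ψ b hb hψ
    let φ' : L.Formula ((Fin 1 ⊕ Fin m) ⊕ D) := ψ.relabel (Sum.elim (fun i => Sum.inl (Sum.inr i))
      fun i => if hi : b i = c then Sum.inl (Sum.inl 0) else
        Sum.inr ⟨b i, (hb i).resolve_left hi⟩)
    have hφ' : ∀ (w : Henkin A → M) (a : Fin m → M) (y : M),
        φ'.Realize (Sum.elim (Sum.elim (fun _ => y) a) (fun z : D => w z)) ↔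
          ψ.Realize (Sum.elim a (Function.update w c y ∘ b)) := by
      intro w a y
      rw [Formula.realize_relabel]
      refine iff_of_eq (congrArg _ (funext ?_))
      rintro (i | i)
      · rfl
      · by_cases hi : b i = c
        · simp [hi]
        · simp [hi]
    obtain ⟨n', χ, d', hχ⟩ := exists_fin_split.{u, v, w} φ'
    -- The prospective solution in `P` counts among the parameters of `χ`, so `γ k` decides the
    -- formula before that solution is known.
    obtain ⟨k, hk⟩ := hγdec (Fin m ⊕ Fin n') (χ.relabel (Equiv.sumAssoc _ _ _))
    let Ψ : L.Formula (Fin m ⊕ D) := Formula.iExs (Fin 1)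
      ((γ k).relabel (Sum.elim Sum.inr (fun z => Sum.inl (Sum.inr z))) ⊓
        φ'.relabel (Sum.elim (Sum.elim Sum.inr (fun i => Sum.inl (Sum.inl i)))
          (fun z => Sum.inl (Sum.inr z))))
    have hΨ : ∀ (v : Henkin A → M) (a : Fin m → M), Ψ.Realize (Sum.elim a (fun z : D => v z)) ↔
        ∃ x, (γ k).Realize (Sum.elim x (fun z : D => v z)) ∧
          φ'.Realize (Sum.elim (Sum.elim x a) (fun z : D => v z)) := by
      intro v a
      simp only [Ψ, Formula.realize_iExs, Formula.realize_inf, Formula.realize_relabel]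
      refine exists_congr fun x => and_congr (iff_of_eq (congrArg _ (funext ?_)))
        (iff_of_eq (congrArg _ (funext ?_)))
      · rintro (i | i) <;> rfl
      · rintro ((i | i) | i) <;> rfl
    obtain ⟨a', ha'⟩ := h.complete_formula Ψ (by
      refine (frequently_extendFilter.1 hψ k).mono ?_
      rintro v ⟨y, hy, a, haP, ha⟩
      exact ⟨a, haP, (hΨ v a).2 ⟨fun _ => y, hy, (hφ' v a y).2 ha⟩⟩)
    let φ'' : L.Formula (Fin 1 ⊕ D) := φ'.relabel
      (Sum.elim (Sum.elim Sum.inl (fun i => Sum.inr (a' i))) Sum.inr)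
    have hφ'' : ∀ (N : Type w) [L.Structure N] (v : D → N) (x : Fin 1 → N),
        φ''.Realize (Sum.elim x v) ↔ φ'.Realize (Sum.elim (Sum.elim x (v ∘ a')) v) := by
      intro N _ v x
      rw [Formula.realize_relabel]
      refine iff_of_eq (congrArg _ (funext ?_))
      rintro ((i | i) | i) <;> rfl
    have hdec : (∀ x, (γ k).Realize (Sum.elim x e) → φ''.Realize (Sum.elim x e)) ∨
        (∀ x, (γ k).Realize (Sum.elim x e) → ¬ φ''.Realize (Sum.elim x e)) := by
      have hk' := hk (Sum.elim a' d')
      have e1 : ∀ x : Fin 1 → Ultrapower U M, (χ.relabel (Equiv.sumAssoc _ _ _)).Realize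
          (Sum.elim x (e ∘ Sum.elim a' d')) ↔ φ''.Realize (Sum.elim x e) := by
        intro x
        rw [hφ'', hχ, Formula.realize_relabel]
        refine iff_of_eq (congrArg _ (funext ?_))
        rintro ((i | i) | i) <;> rfl
      simpa only [e1] using hk'
    refine ⟨fun i => a' i, fun i => Or.inr (a' i).2, ?_⟩
    rcases hdec with hdec | hdec
    · filter_upwards [key φ'' ⟨k, hdec⟩, hle ha'] with w hw hw'
      refine ⟨hw'.1, ?_⟩
      rw [hφ''] at hw
      have := (hφ' w _ (w c)).1 hw
      rwa [Function.update_eq_self] at this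
    -- By the choice of `a'`, some realization of `γ k` satisfies the formula, so `γ k` cannot
    -- refute it.
    · exfalso
      have hall := (h.forall_realize_ultrapower hU ((γ k).imp φ''.not)).1
        (fun x => Formula.realize_imp.2 fun hx => Formula.realize_not.2 (hdec x hx))
      obtain ⟨v, hv, -, hv'⟩ := (hall.and ha').exists
      obtain ⟨x, hx, hx'⟩ := (hΨ v _).1 hv'
      exact Formula.realize_not.1 (Formula.realize_imp.1 (hv x) hx) ((hφ'' _ _ _).2 hx')
  · rintro x (rfl | hx) hfreq
    -- Some `γ k` decides all equations between the new element and old ones. If the new element may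
    -- lie in `P`, completeness gives an old solution `a'` of `γ k` in `P`; as `γ k` does not
    -- exclude `x = a'`, it implies it.
    · let χ : L.Formula (Fin 1 ⊕ Fin 1) :=
        Term.equal (Term.var (Sum.inl 0)) (Term.var (Sum.inr 0))
      obtain ⟨k, hk⟩ := hγdec (Fin 1) χ
      have hχ : ∀ (N : Type w) [L.Structure N] (x y : Fin 1 → N),
          χ.Realize (Sum.elim x y) ↔ x 0 = y 0 := by
        intro N _ x y
        simp [χ]
      obtain ⟨a', ha'⟩ := h.complete_formula (γ k) (by
        refine (frequently_extendFilter.1 hfreq k).mono ?_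
        rintro v ⟨y, hy, hyP⟩
        exact ⟨fun _ => y, fun _ => by simpa using hyP, hy⟩)
      obtain ⟨a, ha⟩ := h.pred_eq (a' 0) (a' 0).2 (ha'.mono fun v hv => hv.1 0).frequently
      refine ⟨a, ?_⟩
      let φ : L.Formula (Fin 1 ⊕ D) := χ.relabel (Sum.map id a')
      have hφ : ∀ (N : Type w) [L.Structure N] (v : D → N) (x : Fin 1 → N),
          φ.Realize (Sum.elim x v) ↔ x 0 = v (a' 0) := by
        intro N _ v x
        simp [φ, Formula.realize_relabel, Sum.elim_comp_map, hχ]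
      rcases hk a' with hk | hk
      · filter_upwards [key φ ⟨k, fun x hx => (hφ _ _ _).2 ((hχ _ _ _).1 (hk x hx))⟩, hle ha]
          with w hw hw'
        exact ((hφ _ _ _).1 hw).trans hw'
      · exfalso
        have hall := (h.forall_realize_ultrapower hU ((γ k).imp φ.not)).1
          (fun x => Formula.realize_imp.2 fun hx => Formula.realize_not.2
            fun h' => hk x hx ((hχ _ _ _).2 ((hφ _ _ _).1 h')))
        obtain ⟨v, hv, -, hv'⟩ := (hall.and ha').exists
        exact Formula.realize_not.1 (Formula.realize_imp.1 (hv _) hv') ((hφ _ _ _).2 rfl)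
    · obtain ⟨a, ha⟩ := h.pred_eq x hx (hfreq.filter_mono hle)
      exact ⟨a, hle ha⟩
  · rintro k n args' (heq | hmem)
    · rw [hcdef] at heq
      injection heq with h1 h2 h3
      subst h1 h2
      obtain rfl := eq_of_heq h3
      refine hθc.mono fun w hw => ?_
      simpa only [hθ', hf₀] using hw
    · exact hle (h.henkin k n args' hmem)

omit [Nonempty M] in
/-- The union of a chain of complete diagrams is a complete diagram. -/
theorem iUnion_of_chain {c : Set (Set (Henkin A) × (Filter (Henkin A → M))ᵒᵈ)}
    (hc : IsChain (· ≤ ·) c) (hne : c.Nonempty)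
    (h : ∀ p ∈ c, IsCompleteDiagram P A form p.1 (OrderDual.ofDual p.2)) :
    IsCompleteDiagram P A form (⋃ p : c, p.1.1) (⨅ p : c, OrderDual.ofDual p.1.2) := by
  have : Nonempty c := hne.to_subtype
  have hdir : Directed (· ≥ ·) fun p : c => OrderDual.ofDual p.1.2 := by
    intro p q
    rcases hc.total p.2 q.2 with hpq | hpq
    · exact ⟨q, hpq.2, le_rfl⟩
    · exact ⟨p, le_rfl, hpq.2⟩
  have hdir' : Directed (· ≤ ·) fun p : c => p.1.1 := by
    intro p q
    rcases hc.total p.2 q.2 with hpq | hpq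
    · exact ⟨q, hpq.1, le_rfl⟩
    · exact ⟨p, le_rfl, hpq.1⟩
  have hfin : ∀ {n : ℕ} (d : Fin n → Henkin A), (∀ i, d i ∈ ⋃ p : c, p.1.1) →
      ∃ p : c, ∀ i, d i ∈ p.1.1 := by
    intro n d hd
    simp only [mem_iUnion] at hd
    choose f hf using hd
    obtain ⟨p, hp⟩ := hdir'.finite_le f
    exact ⟨p, fun i => hp i (hf i)⟩
  have hle : ∀ p : c, (⨅ p : c, OrderDual.ofDual p.1.2) ≤ OrderDual.ofDual p.1.2 :=
    fun p => iInf_le _ p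
  refine ⟨?_, ?_, ?_, ?_, ?_, ?_, ?_, ?_⟩
  · exact iInf_neBot_of_directed' hdir fun p => (h p p.2).neBot
  · intro S hS
    obtain ⟨p, hp⟩ := (mem_iInf_of_directed hdir S).1 hS
    obtain ⟨S', hS', hsub, hsat⟩ := (h p p.2).saturated S hp
    exact ⟨S', hle p hS', hsub, fun v hv v' hv' =>
      hsat v hv v' fun x hx => hv' x (mem_iUnion.2 ⟨p, hx⟩)⟩
  · obtain ⟨p, hp⟩ := hne
    exact fun a => mem_iUnion.2 ⟨⟨p, hp⟩, (h p hp).base_mem a⟩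
  · obtain ⟨p, hp⟩ := hne
    exact fun a => hle ⟨p, hp⟩ ((h p hp).base_eq a)
  · intro n φ d hd
    obtain ⟨p, hp⟩ := hfin d hd
    exact ((h p p.2).decides n φ d hp).imp (fun h' => hle p h') (fun h' => hle p h')
  · intro m n ψ b hb hψ
    obtain ⟨p, hp⟩ := hfin b hb
    obtain ⟨a, ha, h'⟩ := (h p p.2).complete m n ψ b hp (hψ.filter_mono (hle p))
    exact ⟨a, fun i => mem_iUnion.2 ⟨p, ha i⟩, hle p h'⟩
  · intro x hx hfreq
    obtain ⟨p, hp⟩ := mem_iUnion.1 hx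
    obtain ⟨a, ha⟩ := (h p p.2).pred_eq x hp (hfreq.filter_mono (hle p))
    exact ⟨a, hle p ha⟩
  · intro k n args hmem
    obtain ⟨p, hp⟩ := mem_iUnion.1 hmem
    exact hle p ((h p p.2).henkin k n args hp)

/-- A complete set, with its elements named by themselves, is a complete diagram. -/
theorem of_isCompleteSet (hA : IsCompleteSet P A) :
    IsCompleteDiagram P A form (range Henkin.base)
      (𝓟 {v : Henkin A → M | ∀ a : A, v (Henkin.base a) = a}) := by
  have hval : ∀ {n : ℕ} (d : Fin n → Henkin A), (∀ i, d i ∈ range (Henkin.base (A := A))) →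
      ∃ a : Fin n → A, ∀ v : Henkin A → M, (∀ a : A, v (Henkin.base a) = a) →
        v ∘ d = fun i => (a i : M) := by
    intro n d hd
    choose a ha using hd
    exact ⟨a, fun v hv => funext fun i => by rw [Function.comp_apply, ← ha, hv]⟩
  refine ⟨?_, ?_, ?_, ?_, ?_, ?_, ?_, ?_⟩
  · refine principal_neBot_iff.2 ?_
    exact ⟨fun x => match x with
      | .base a => a
      | .wit _ _ _ => Classical.arbitrary M, fun a => rfl⟩
  · intro S hS
    refine ⟨_, mem_principal_self _, mem_principal.1 hS, fun v hv v' hv' a => ?_⟩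
    rw [hv' _ ⟨a, rfl⟩]
    exact hv a
  · exact fun a => ⟨a, rfl⟩
  · exact fun a => eventually_principal.2 fun v hv => hv a
  · intro n φ d hd
    obtain ⟨a, ha⟩ := hval d hd
    simp only [eventually_principal]
    by_cases hφ : φ.Realize fun i => (a i : M)
    · exact Or.inl fun v hv => by rwa [ha v hv]
    · exact Or.inr fun v hv => by rwa [ha v hv]
  · intro m n ψ b hb hψ
    obtain ⟨b', hb'⟩ := hval b hb
    simp only [frequently_principal, eventually_principal] at hψ ⊢
    obtain ⟨v, hv, a, haP, ha⟩ := hψ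
    rw [hb' v hv] at ha
    obtain ⟨a', ha'P, ha'⟩ := hA m n ψ _ (fun i => (b' i).2) ⟨a, haP, ha⟩
    refine ⟨fun i => Henkin.base ⟨a' i, (ha'P i).1⟩, fun i => ⟨_, rfl⟩, fun v hv => ⟨fun i => ?_, ?_⟩⟩
    · rw [hv]
      exact (ha'P i).2
    · rw [hb' v hv]
      convert ha' using 2
      ext i
      exact hv _
  · rintro _ ⟨a, rfl⟩ -
    exact ⟨a, eventually_principal.2 fun v hv => hv a⟩
  · rintro k n args ⟨a, ha⟩
    cases ha

end IsCompleteDiagram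

/-- A countable stable theory has the full existence property. -/
theorem hasFullExistence_of_isStable {T : L.Theory} (P : L.Relations 1)
    (hL : L.card ≤ Cardinal.aleph0) (hT : IsStable.{u, v, w} T) :
    HasFullExistence.{u, v, w} T P := by
  classical
  intro M _ _ _ A hA
  have hcount : ∀ n, Countable (L.Formula (Fin n ⊕ Fin 1)) := fun n => countable_formula hL _
  have henum : ∀ n, ∃ f : ℕ → L.Formula (Fin n ⊕ Fin 1), Function.Surjective f := fun n =>
    have : Nonempty (L.Formula (Fin n ⊕ Fin 1)) := ⟨⊤⟩
    exists_surjective_nat _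
  choose form hform using henum
  let good : Set (Set (Henkin A) × (Filter (Henkin A → M))ᵒᵈ) :=
    {p | IsCompleteDiagram P A form p.1 (OrderDual.ofDual p.2)}
  obtain ⟨⟨D, F⟩, -, hmax⟩ := zorn_le_nonempty₀ good (fun c hc hchain p hp =>
    ⟨(⋃ p : c, p.1.1, OrderDual.toDual (⨅ p : c, OrderDual.ofDual p.1.2)),
      IsCompleteDiagram.iUnion_of_chain hchain ⟨p, hp⟩ fun q hq => hc hq,
      fun q hq => ⟨fun x hx => mem_iUnion.2 ⟨⟨q, hq⟩, hx⟩,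
        iInf_le (fun p : c => OrderDual.ofDual p.1.2) ⟨q, hq⟩⟩⟩)
    (range Henkin.base, OrderDual.toDual (𝓟 {v : Henkin A → M | ∀ a : A, v (Henkin.base a) = a}))
    (IsCompleteDiagram.of_isCompleteSet hA)
  have h : IsCompleteDiagram P A form D (OrderDual.ofDual F) := hmax.prop
  set F₀ : Filter (Henkin A → M) := OrderDual.ofDual F
  have hwit : ∀ k n (args : Fin n → Henkin A), (∀ i, args i ∈ D) → Henkin.wit k n args ∈ D := by
    intro k n args hargs
    -- A missing witness could be adjoined, against maximality.
    by_contra hc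
    obtain ⟨F', hF', h'⟩ := h.exists_extend hL hT hargs hc
    have := hmax.le_of_ge (y := (insert (Henkin.wit k n args) D, OrderDual.toDual F')) h'
      ⟨subset_insert _ _, hF'⟩
    exact hc (this.1 (mem_insert _ _))
  have := h.neBot
  let U : Ultrafilter (Henkin A → M) := Ultrafilter.of F₀
  have hU : (U : Filter (Henkin A → M)) ≤ F₀ := Ultrafilter.of_le F₀
  let e : Henkin A → Ultrapower U M := fun x => ultraMk U fun v => v x
  have hsol : ∀ (n : ℕ) (φ : L.Formula (Fin n ⊕ Fin 1)) (args : Fin n → Henkin A),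
      (∀ i, args i ∈ D) → (∃ y, φ.Realize (Sum.elim (e ∘ args) y)) →
        ∃ x ∈ D, φ.Realize (Sum.elim (e ∘ args) fun _ => e x) := by
    rintro n φ args hargs ⟨y, hy⟩
    obtain ⟨k, rfl⟩ := hform n φ
    have hx := hwit k n args hargs
    refine ⟨_, hx, ?_⟩
    obtain ⟨y', hy'⟩ := ultraMk_surjective (y 0)
    have h1 := (realize_ultraMk (form n k)
      (Sum.elim (fun i (v : Henkin A → M) => v (args i)) fun _ => y') _
      (by rintro (i | i)
          · rfl
          · rw [Subsingleton.elim i 0]; exact hy'.symm)).1 hy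
    refine (realize_ultraMk (form n k) (Sum.elim (fun i (v : Henkin A → M) => v (args i))
      fun _ v => v (Henkin.wit k n args)) _ (by rintro (i | i) <;> rfl)).2 ?_
    filter_upwards [h1, hU (h.henkin k n args hx)] with v hv hv'
    have e1 : ∀ z : (Henkin A → M) → M,
        (fun i => Sum.elim (fun i (v : Henkin A → M) => v (args i)) (fun _ : Fin 1 => z) i v) =
          Sum.elim (v ∘ args) fun _ => z v := by
      intro z
      ext (i | i) <;> rfl
    rw [e1] at hv
    have := hv' ⟨_, hv⟩
    rwa [← e1 (fun v => v (Henkin.wit k n args))] at this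
  let N₀ : L.Substructure (Ultrapower U M) :=
    { carrier := e '' D
      fun_mem := by
        intro n f x hx
        choose args hargs hxa using hx
        have hx' : e ∘ args = x := funext hxa
        -- Closure under functions is the witness property for the formula `y = f(x)`.
        obtain ⟨z, hz, hz'⟩ := hsol n (Term.equal (Term.var (Sum.inr 0))
          (Term.func f fun i => Term.var (Sum.inl i))) args hargs
          ⟨fun _ => Structure.funMap f x, by simp [hx']⟩
        refine ⟨z, hz, ?_⟩
        simpa [hx'] using hz' }
  have hN : N₀.IsElementary := by
    refine Substructure.isElementary_of_exists _ fun n φ x a ha => ?_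
    choose args hargs hxa using fun i => (x i).2
    have hx' : e ∘ args = (↑) ∘ x := funext hxa
    let ψ : L.Formula (Fin n ⊕ Fin 1) := φ.toFormula.relabel
      (Sum.elim Empty.elim (Fin.snoc (α := fun _ => Fin n ⊕ Fin 1) Sum.inl (Sum.inr 0)))
    have hψ : ∀ (y : Fin n → Ultrapower U M) (z : Fin 1 → Ultrapower U M),
        ψ.Realize (Sum.elim y z) ↔ φ.Realize default (Fin.snoc y (z 0) : _ → _) := by
      intro y z
      rw [Formula.realize_relabel, BoundedFormula.realize_toFormula]
      have e1 : (Sum.elim y z ∘ Sum.elim Empty.elim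
          (Fin.snoc (α := fun _ => Fin n ⊕ Fin 1) Sum.inl (Sum.inr 0))) ∘ Sum.inr =
          (Fin.snoc y (z 0) : Fin (n + 1) → Ultrapower U M) := by
        ext i
        refine Fin.lastCases ?_ (fun i => ?_) i <;> simp
      rw [e1]
      exact iff_of_eq (congrArg (fun q => φ.Realize q _) (Subsingleton.elim _ _))
    obtain ⟨z, hz, hz'⟩ := hsol n ψ args hargs ⟨fun _ => a, by rw [hψ, hx']; exact ha⟩
    rw [hψ, hx'] at hz'
    exact ⟨⟨e z, z, hz, rfl⟩, hz'⟩
  refine ⟨Ultrapower U M, inferInstance, ultraDiag L U, ⟨N₀, hN⟩, ?_, ?_⟩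
  · rintro _ ⟨a, ha, rfl⟩
    exact ⟨Henkin.base ⟨a, ha⟩, h.base_mem _, ultraMk_eq_iff.2 (hU (h.base_eq ⟨a, ha⟩))⟩
  · ext z
    constructor
    · rintro ⟨⟨x, hx, rfl⟩, hz⟩
      refine ⟨?_, hz⟩
      have hz' := ultraMk_mem_predSet.1 hz
      obtain ⟨a, ha⟩ := h.pred_eq x hx (hz'.frequently.filter_mono hU)
      exact ⟨a, a.2, (ultraMk_eq_iff.2 (hU ha)).symm⟩
    · rintro ⟨⟨a, ha, rfl⟩, hz⟩
      exact ⟨⟨Henkin.base ⟨a, ha⟩, h.base_mem _, ultraMk_eq_iff.2 (hU (h.base_eq ⟨a, ha⟩))⟩, hz⟩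

end Existence

/-! ### Definability of types and stable embeddedness -/

section StablyEmbedded

variable {L : FirstOrder.Language.{u, v}}

/-- The set of parameters for which a formula has large rank is definable. -/
theorem exists_treeRank_formula (M : Type*) [L.Structure M] {m n : ℕ}
    (φ : L.Formula (Fin m ⊕ Fin n)) (k : ℕ) {ζ : Type*} (ρ : L.Formula (ζ ⊕ Fin m)) :
    ∃ σ : L.Formula ζ, ∀ z : ζ → M, σ.Realize z ↔
      treeRank (fun (x : Fin m → M) (y : Fin n → M) => φ.Realize (Sum.elim x y)) univ k
        {x | ρ.Realize (Sum.elim z x)} := by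
  induction k generalizing ζ with
  | zero =>
    refine ⟨ρ.iExs (Fin m), fun z => ?_⟩
    rw [Formula.realize_iExs]
    rfl
  | succ k ih =>
    let φ' : L.Formula ((ζ ⊕ Fin n) ⊕ Fin m) :=
      φ.relabel (Sum.elim Sum.inr fun i => Sum.inl (Sum.inr i))
    let ρ' : L.Formula ((ζ ⊕ Fin n) ⊕ Fin m) := ρ.relabel (Sum.map Sum.inl id)
    obtain ⟨σ₁, h₁⟩ := ih (ρ' ⊓ φ')
    obtain ⟨σ₂, h₂⟩ := ih (ρ' ⊓ φ'.not)
    refine ⟨(σ₁ ⊓ σ₂).iExs (Fin n), fun z => ?_⟩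
    have hφ' : ∀ (y : Fin n → M) (x : Fin m → M),
        φ'.Realize (Sum.elim (Sum.elim z y) x) ↔ φ.Realize (Sum.elim x y) := by
      intro y x
      rw [Formula.realize_relabel]
      refine iff_of_eq (congrArg _ (funext ?_))
      rintro (i | i) <;> rfl
    have hρ' : ∀ (y : Fin n → M) (x : Fin m → M),
        ρ'.Realize (Sum.elim (Sum.elim z y) x) ↔ ρ.Realize (Sum.elim z x) := by
      intro y x
      rw [Formula.realize_relabel, Sum.elim_comp_map, Sum.elim_comp_inl, Function.comp_id]
    simp only [Formula.realize_iExs, Formula.realize_inf, h₁, h₂, Formula.realize_not, hφ', hρ',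
      treeRank, mem_univ, true_and]
    rfl

/-- In a stable theory every predicate is stably embedded. -/
theorem isStablyEmbedded_of_isStable {T : L.Theory} (P : L.Relations 1)
    (hT : IsStable.{u, v, w} T) : IsStablyEmbedded.{u, v, w} T P := by
  classical
  intro M _ _ _ n S hS hdef
  obtain ⟨φ₀, hφ₀⟩ := definable_iff_exists_formula_sum.1 hdef
  obtain ⟨m, ψ, d, hd⟩ := exists_fin_split.{u, v, w} (φ₀.relabel Sum.swap)
  let b : Fin m → M := fun i => d i
  let φ : L.Formula (Fin m ⊕ Fin n) := ψ.relabel Sum.swap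
  have hφ : ∀ a : Fin n → M, a ∈ S ↔ φ.Realize (Sum.elim b a) := by
    intro a
    have h := hd M a (fun z => (z : M))
    rw [Formula.realize_relabel, Sum.elim_swap] at h
    rw [hφ₀, mem_ofPred_eq, h, Formula.realize_relabel, Sum.elim_swap]
    rfl
  -- The formulas over `P` satisfied by the parameter tuple `b`. With `ρ` of minimal rank among
  -- them, `φ(b, a)` holds for `a` in `P` exactly when `ρ ∧ φ(x, a)` still has rank at least `k`:
  -- otherwise `ρ ∧ ¬φ(x, a)` also does, and `a` is the root of a tree of height `k + 1`.
  let 𝓩 : Set (Set (Fin m → M)) := {Z | b ∈ Z ∧ ∃ ρ : L.Formula (predSet P M ⊕ Fin m),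
    Z = {x | ρ.Realize (Sum.elim (↑) x)}}
  obtain ⟨k, _, ⟨hb, ρ, rfl⟩, hk, hmin⟩ := exists_minimal_treeRank (𝓩 := 𝓩)
    (fun Z hZ => ⟨b, hZ.1⟩) ⟨univ, mem_univ _, ⊤, by ext; simp⟩
    (exists_not_treeRank_of_isStable hT M φ)
  let φ' : L.Formula ((predSet P M ⊕ Fin n) ⊕ Fin m) :=
    φ.relabel (Sum.elim Sum.inr fun i => Sum.inl (Sum.inr i))
  let ρ' : L.Formula ((predSet P M ⊕ Fin n) ⊕ Fin m) := ρ.relabel (Sum.map Sum.inl id)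
  obtain ⟨σ, hσ⟩ := exists_treeRank_formula M φ k (ρ' ⊓ φ')
  have hinter : ∀ a : Fin n → M,
      {x | (ρ' ⊓ φ').Realize (Sum.elim (Sum.elim ((↑) : predSet P M → M) a) x)} =
        {x | ρ.Realize (Sum.elim (↑) x)} ∩ {x | φ.Realize (Sum.elim x a)} := by
    intro a
    ext x
    simp only [mem_ofPred_eq, mem_inter_iff, Formula.realize_inf]
    refine and_congr ?_ ?_
    · rw [Formula.realize_relabel, Sum.elim_comp_map, Sum.elim_comp_inl, Function.comp_id]
    · rw [Formula.realize_relabel]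
      refine iff_of_eq (congrArg _ (funext ?_))
      rintro (i | i) <;> rfl
  rw [definable_iff_exists_formula_sum]
  refine ⟨σ ⊓ Formula.iInf fun i : Fin n => P.formula₁ (Term.var (Sum.inr i)), ?_⟩
  ext a
  have hP : (∀ i, a i ∈ predSet P M) ↔ (Formula.iInf fun i : Fin n =>
      P.formula₁ (Term.var (Sum.inr i))).Realize (Sum.elim ((↑) : predSet P M → M) a) := by
    simp only [Formula.realize_iInf, Formula.realize_rel₁, Term.realize_var, Sum.elim_inr]
    rfl
  rw [mem_ofPred_eq, Formula.realize_inf, ← hP, hσ, hinter]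
  by_cases haP : ∀ i, a i ∈ predSet P M
  swap
  · exact iff_of_false (fun ha => haP (hS a ha)) fun h => haP h.2
  simp only [haP, implies_true, and_true]
  have hsub : ∀ χ : L.Formula (Fin m ⊕ Fin n), χ.Realize (Sum.elim b a) →
      {x | ρ.Realize (Sum.elim (↑) x)} ∩ {x | χ.Realize (Sum.elim x a)} ∈ 𝓩 := by
    intro χ hχ
    refine ⟨⟨hb, hχ⟩, ρ ⊓ χ.relabel (Sum.elim Sum.inr fun i => Sum.inl ⟨a i, haP i⟩), ?_⟩
    ext x
    simp only [mem_ofPred_eq, mem_inter_iff, Formula.realize_inf]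
    refine and_congr Iff.rfl ?_
    rw [Formula.realize_relabel]
    refine iff_of_eq (congrArg _ (funext ?_))
    rintro (i | i) <;> rfl
  rw [hφ]
  constructor
  · exact fun h => hmin _ (hsub φ h)
  · intro h
    by_contra hn
    have := hmin _ (hsub φ.not (Formula.realize_not.2 hn))
    simp only [Formula.realize_not] at this
    exact hk ⟨a, mem_univ _, h, this⟩

end StablyEmbedded

/-! ### The Morleyization -/

section MorleyizationTheorems

variable {L : FirstOrder.Language.{u, v}}

/-- The terms of the language of the Morleyization are the terms of the base language. -/
def termToBase {α : Type*} : (morleyLanguage L).Term α → L.Term α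
  | .var a => .var a
  | .func (l := l) f ts => Sum.elim (fun g : L.Functions l => Term.func g fun i => termToBase (ts i))
      (fun g : Empty => g.elim) (f : L.Functions l ⊕ Empty)

/-- The translation of the formulas of the language of the Morleyization to the base language. -/
def formulaToBase {α : Type*} :
    ∀ {n : ℕ}, (morleyLanguage L).BoundedFormula α n → L.BoundedFormula α n
  | _, .falsum => .falsum
  | _, .equal s t => .equal (termToBase s) (termToBase t)
  | n, .rel (l := l) R ts => Sum.elim
      (fun r : L.Relations l => BoundedFormula.rel r fun i => termToBase (ts i))
      (fun φ : L.Formula (Fin l) => BoundedFormula.relabel (id : α ⊕ Fin n → α ⊕ Fin n)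
        (BoundedFormula.subst φ fun i => termToBase (ts i)))
      (R : L.Relations l ⊕ L.Formula (Fin l))
  | _, .imp φ ψ => .imp (formulaToBase φ) (formulaToBase ψ)
  | _, .all φ => .all (formulaToBase φ)

variable {M : Type*} [L.Structure M]

theorem realize_termToBase {α : Type*} (t : (morleyLanguage L).Term α) (v : α → M) :
    (termToBase t).realize v = t.realize v := by
  induction t with
  | var => rfl
  | func f ts ih =>
    rcases f with f | f
    · change Structure.funMap f (fun i => (termToBase (ts i)).realize v) =
        Structure.funMap f fun i => (ts i).realize v
      simp only [ih]
    · exact f.elim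

theorem realize_formulaToBase {α : Type*} {n : ℕ} (φ : (morleyLanguage L).BoundedFormula α n)
    (v : α → M) (xs : Fin n → M) : (formulaToBase φ).Realize v xs ↔ φ.Realize v xs := by
  induction φ with
  | falsum => rfl
  | equal s t => simp only [formulaToBase, BoundedFormula.Realize, realize_termToBase]
  | rel R ts =>
    rcases R with R | R
    · change Structure.RelMap R (fun i => (termToBase (ts i)).realize (Sum.elim v xs)) ↔
        Structure.RelMap R fun i => (ts i).realize (Sum.elim v xs)
      simp only [realize_termToBase]
    · obtain ⟨ψ, rfl⟩ : ∃ ψ : L.BoundedFormula (Fin _) 0, ψ = R := ⟨R, rfl⟩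
      change (BoundedFormula.relabel (id : _ ⊕ Fin _ → _ ⊕ Fin _) (BoundedFormula.subst
        ψ fun i => termToBase (ts i))).Realize v xs ↔
        Formula.Realize (L := L) ψ fun i => (ts i).realize (Sum.elim v xs)
      rw [BoundedFormula.realize_relabel, BoundedFormula.realize_subst]
      simp only [realize_termToBase]
      exact iff_of_eq (congrArg _ (Subsingleton.elim _ _))
  | imp _ _ ih₁ ih₂ => simp only [formulaToBase, BoundedFormula.Realize, ih₁, ih₂]
  | all _ ih => simp only [formulaToBase, BoundedFormula.Realize, ih]

theorem realize_formulaToBase_formula {α : Type*} (φ : (morleyLanguage L).Formula α) (v : α → M) :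
    Formula.Realize (L := L) (formulaToBase φ) v ↔ φ.Realize v :=
  realize_formulaToBase φ v _

theorem realize_formulaPred {n : ℕ} (ψ : L.Formula (Fin n)) (v : Fin n → M) :
    ((formulaPred ψ).formula Term.var).Realize v ↔ ψ.Realize v :=
  (Formula.realize_rel (L := morleyLanguage L)).trans Iff.rfl

instance models_morleyization (T : L.Theory) [M ⊨ T] : M ⊨ morleyization T := by
  refine ⟨?_⟩
  rintro σ (hσ | ⟨n, φ, rfl⟩)
  · obtain ⟨τ, hτ, rfl⟩ := hσ
    exact (LHom.realize_onSentence M LHom.sumInl τ).2 (Theory.realize_sentence_of_mem T hτ)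
  · rw [Sentence.Realize, Formula.realize_iAlls]
    intro x
    rw [Formula.realize_relabel, Formula.realize_iff, LHom.realize_onFormula]
    rw [Formula.realize_rel]
    rfl

/-- The models of the Morleyization are the canonical expansions of the models of the theory. -/
theorem exists_eq_expansion {T : L.Theory} {N : Type*} [S : (morleyLanguage L).Structure N]
    [hN : N ⊨ morleyization T] :
    ∃ S₀ : L.Structure N, N ⊨ T ∧
      S = @Language.sumStructure L (formulaPredicates L) N S₀ formulaPredicatesStructure := by
  let S₀ : L.Structure N := (LHom.sumInl : L →ᴸ morleyLanguage L).reduct N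
  have hexp := LHom.isExpansionOn_reduct (LHom.sumInl : L →ᴸ morleyLanguage L) N
  refine ⟨S₀, ⟨fun σ hσ => ?_⟩, ?_⟩
  · have := Theory.realize_sentence_of_mem (M := N) (morleyization T)
      (Or.inl (Set.mem_image_of_mem _ hσ))
    exact (LHom.realize_onSentence N LHom.sumInl σ).1 this
  · refine Structure.ext ?_ ?_
    · ext n f x
      rcases f with f | f
      · rfl
      · exact f.elim
    · ext n R x
      rcases R with R | R
      · rfl
      · have := Theory.realize_sentence_of_mem (M := N) (morleyization T)
          (Or.inr ⟨n, (R : L.Formula (Fin n)), rfl⟩)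
        rw [Sentence.Realize, Formula.realize_iAlls] at this
        have h := this x
        rw [Formula.realize_relabel, Formula.realize_iff] at h
        exact (Formula.realize_rel (L := morleyLanguage L)).symm.trans
          (h.trans (LHom.realize_onFormula LHom.sumInl (R : L.Formula (Fin n))))

theorem card_morleyLanguage_le (hL : L.card ≤ Cardinal.aleph0) :
    (morleyLanguage L).card ≤ Cardinal.aleph0 := by
  have : ∀ n, Countable (L.Formula (Fin n)) := fun n => countable_formula hL _
  rw [Language.card_sum]
  refine Cardinal.add_le_aleph0.2 ⟨Cardinal.lift_le_aleph0.2 hL, Cardinal.lift_le_aleph0.2 ?_⟩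
  have h1 : Countable (Σ n, (formulaPredicates L).Functions n) :=
    have : ∀ n, Countable ((formulaPredicates L).Functions n) :=
      fun n => inferInstanceAs (Countable Empty)
    inferInstance
  have h2 : Countable (Σ n, (formulaPredicates L).Relations n) :=
    have : ∀ n, Countable ((formulaPredicates L).Relations n) := this
    inferInstance
  exact Cardinal.mk_le_aleph0_iff.2
    (inferInstanceAs (Countable ((Σ n, (formulaPredicates L).Functions n) ⊕
      (Σ n, (formulaPredicates L).Relations n))))

theorem morleyization_isComplete {T : L.Theory} (hT : T.IsComplete) :
    (morleyization T).IsComplete := by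
  obtain ⟨⟨N⟩, hT⟩ := hT
  refine ⟨⟨Theory.ModelType.of (morleyization T) N⟩, fun φ => ?_⟩
  refine (hT (formulaToBase φ)).imp (fun h => ?_) (fun h => ?_)
  · rw [Theory.models_sentence_iff] at h ⊢
    rintro ⟨N, hN⟩
    obtain ⟨S₀, hN', rfl⟩ := exists_eq_expansion (T := T) (N := N)
    exact (realize_formulaToBase_formula φ _).1 (h (Theory.ModelType.of T N))
  · rw [Theory.models_sentence_iff] at h ⊢
    rintro ⟨N, hN⟩
    obtain ⟨S₀, hN', rfl⟩ := exists_eq_expansion (T := T) (N := N)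
    exact fun h' => (h (Theory.ModelType.of T N)) ((realize_formulaToBase_formula φ _).2 h')

theorem morleyization_isStable {T : L.Theory} (hT : IsStable.{u, v, w} T) :
    IsStable.{u, max u v, w} (morleyization T) := by
  intro m n φ N S hN _
  obtain ⟨S₀, hN', rfl⟩ := exists_eq_expansion (T := T) (N := N)
  rintro ⟨a, b, hab⟩
  exact hT m n (formulaToBase φ) N
    ⟨a, b, fun i j => (realize_formulaToBase_formula φ _).trans (hab i j)⟩

theorem morleyization_hasPredicateElimination (T : L.Theory) :
    HasPredicateElimination (morleyization T) := by
  intro n φ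
  refine ⟨formulaPred (formulaToBase φ), ?_⟩
  rintro ⟨N, hN⟩ v xs
  obtain ⟨S₀, hN', rfl⟩ := exists_eq_expansion (T := T) (N := N)
  rw [BoundedFormula.realize_iff, ← realize_formulaToBase]
  rw [Subsingleton.elim xs default]
  exact (realize_formulaPred (formulaToBase φ : L.Formula (Fin n)) v).symm

/-- A substructure inherits its relations, so the predicate naming the translated formula has on
`M|_P` the trace of its meaning in `M`; an atomic formula defines the set. -/
theorem morleyization_hasUniformReduction (T : L.Theory) (P : (morleyLanguage L).Relations 1) :
    HasUniformReduction.{u, max u v, w} (morleyization T) P := by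
  intro N S hN _ n X hX hdef
  obtain ⟨S₀, hN', rfl⟩ := exists_eq_expansion (T := T) (N := N)
  obtain ⟨φ, rfl⟩ := empty_definable_iff.1 hdef
  refine empty_definable_iff.2
    ⟨(formulaPred (formulaToBase φ : L.Formula (Fin n))).formula Term.var, ?_⟩
  ext a
  refine Iff.trans ?_ (Formula.realize_rel (L := morleyLanguage L)
    (R := formulaPred (formulaToBase φ : L.Formula (Fin n))) (v := a)).symm
  exact (realize_formulaToBase_formula φ _).symm

theorem isCompleteSet_morleyization_iff (P : L.Relations 1) (A : Set M) :
    IsCompleteSet P A ↔ IsCompleteSet (L := morleyLanguage L) (Sum.inl P) A := by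
  constructor
  · intro h m n ψ b hb hψ
    have := h m n (formulaToBase ψ) b hb
    simp only [realize_formulaToBase_formula] at this
    exact this hψ
  · intro h m n ψ b hb hψ
    have := h m n (LHom.sumInl.onFormula ψ) b hb
    simp only [LHom.realize_onFormula] at this
    exact this hψ

end MorleyizationTheorems

/-! ### Coset covers and Boolean combinations of subgroups -/

section SubgroupCombinations

open scoped Pointwise

theorem AddSubgroup.mem_finset_inf_id {G : Type*} [AddGroup G] {s : Finset (AddSubgroup G)} {x : G} :
    x ∈ s.inf id ↔ ∀ K ∈ s, x ∈ K := by
  simp [Finset.inf_eq_iInf, AddSubgroup.mem_iInf]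

/-- The set `A` is empty or a coset of `K`. -/
def IsCosetOrEmpty {G : Type*} [AddCommGroup G] (K : AddSubgroup G) (A : Set G) : Prop :=
  ∀ x ∈ A, ∀ y, y ∈ A ↔ y - x ∈ K

/-- Whether finitely many cosets cover an abelian group depends only on their intersection
pattern. -/
theorem iUnion_eq_univ_of_same_pattern {G ι : Type*} [AddCommGroup G] (𝓚 : Finset ι)
    (K : ι → AddSubgroup G) (A A' : ι → Set G) (hA : ∀ i, IsCosetOrEmpty (K i) (A i))
    (hA' : ∀ i, IsCosetOrEmpty (K i) (A' i))
    (hpat : ∀ t ⊆ 𝓚, (∃ x, ∀ i ∈ t, x ∈ A i) ↔ ∃ x, ∀ i ∈ t, x ∈ A' i)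
    (hcov : ∀ x, ∃ i ∈ 𝓚, x ∈ A' i) (x : G) : ∃ i ∈ 𝓚, x ∈ A i := by
  classical
  let 𝓢 := 𝓚.filter fun i => (A' i).Nonempty
  choose! g hg using fun (i : ι) (hi : (A' i).Nonempty) => hi
  have hcoset : ∀ i ∈ 𝓢, g i +ᵥ (K i : Set G) = A' i := by
    intro i hi
    ext y
    rw [hA' i (g i) (hg i (Finset.mem_filter.1 hi).2), mem_vadd_set_iff_neg_vadd_mem, vadd_eq_add,
      SetLike.mem_coe, neg_add_eq_sub]
  have hcov' : ⋃ i ∈ 𝓢, g i +ᵥ (K i : Set G) = univ := by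
    refine eq_univ_of_forall fun y => ?_
    obtain ⟨i, hi, hy⟩ := hcov y
    have hi' : i ∈ 𝓢 := Finset.mem_filter.2 ⟨hi, y, hy⟩
    exact mem_iUnion₂.2 ⟨i, hi', (hcoset i hi').symm ▸ hy⟩
  -- Neumann's lemma: cosets of subgroups of infinite index may be dropped from a finite cover. What
  -- remains can be counted in a finite quotient.
  have hfin := AddSubgroup.leftCoset_cover_filter_FiniteIndex hcov'
  let 𝓙 := 𝓢.filter fun i => (K i).FiniteIndex
  have h𝓙 : 𝓙 ⊆ 𝓚 := (Finset.filter_subset _ _).trans (Finset.filter_subset _ _)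
  have hcovJ : ∀ y, ∃ i ∈ 𝓙, y ∈ A' i := by
    intro y
    obtain ⟨i, hi, hy⟩ := mem_iUnion₂.1 (hfin.symm ▸ mem_univ y)
    exact ⟨i, hi, hcoset i (Finset.mem_filter.1 hi).1 ▸ hy⟩
  let D : AddSubgroup G := ⨅ i ∈ 𝓙, K i
  have hD : D.FiniteIndex := AddSubgroup.finiteIndex_iInf' _ fun i hi => (Finset.mem_filter.1 hi).2
  have hDle : ∀ i ∈ 𝓙, D ≤ K i := fun i hi => iInf₂_le i hi
  have hQ : Finite (G ⧸ D) := inferInstance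
  let _ : Fintype (G ⧸ D) := Fintype.ofFinite _
  let img : (ι → Set G) → ι → Finset (G ⧸ D) := fun B i =>
    Finset.univ.filter fun q => ∃ y ∈ B i, (QuotientAddGroup.mk y : G ⧸ D) = q
  have himg : ∀ B : ι → Set G, (∀ i, IsCosetOrEmpty (K i) (B i)) → ∀ i ∈ 𝓙, ∀ y : G,
      (QuotientAddGroup.mk y : G ⧸ D) ∈ img B i ↔ y ∈ B i := by
    intro B hB i hi y
    simp only [img, Finset.mem_filter, Finset.mem_univ, true_and]
    constructor
    · rintro ⟨z, hz, hzy⟩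
      rw [hB i z hz]
      rw [QuotientAddGroup.eq, neg_add_eq_sub] at hzy
      exact hDle i hi hzy
    · exact fun hy => ⟨y, hy, rfl⟩
  have hinf : ∀ B : ι → Set G, (∀ i, IsCosetOrEmpty (K i) (B i)) → ∀ t ⊆ 𝓙, ∀ y : G,
      (QuotientAddGroup.mk y : G ⧸ D) ∈ t.inf (img B) ↔ ∀ i ∈ t, y ∈ B i := by
    intro B hB t ht y
    rw [Finset.mem_inf]
    exact forall₂_congr fun i hi => himg B hB i (ht hi) y
  have hcard : ∀ t ⊆ 𝓙, (t.inf (img A)).card = (t.inf (img A')).card := by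
    intro t ht
    by_cases hne : ∃ x, ∀ i ∈ t, x ∈ A i
    · obtain ⟨y', hy'⟩ := (hpat t (ht.trans h𝓙)).1 hne
      obtain ⟨y, hy⟩ := hne
      -- Nonempty intersections of the two families are cosets of the same subgroup, hence
      -- translates. With equal cardinalities for all intersections, inclusion-exclusion gives
      -- equally large uncovered parts.
      refine Finset.card_equiv (Equiv.addRight (QuotientAddGroup.mk (y' - y) : G ⧸ D)) fun q => ?_
      obtain ⟨z, rfl⟩ := QuotientAddGroup.mk_surjective q
      rw [Equiv.coe_addRight]
      change _ ↔ (QuotientAddGroup.mk (z + (y' - y)) : G ⧸ D) ∈ _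
      rw [hinf A hA t ht, hinf A' hA' t ht]
      refine forall₂_congr fun i hi => ?_
      rw [hA i y (hy i hi), hA' i y' (hy' i hi)]
      exact iff_of_eq (congrArg (· ∈ K i) (by abel))
    · have hne' : ¬ ∃ x, ∀ i ∈ t, x ∈ A' i := fun h => hne ((hpat t (ht.trans h𝓙)).2 h)
      have hempty : ∀ B : ι → Set G, (∀ i, IsCosetOrEmpty (K i) (B i)) →
          (¬ ∃ x, ∀ i ∈ t, x ∈ B i) → t.inf (img B) = ∅ := by
        intro B hB hn
        refine Finset.eq_empty_of_forall_notMem fun q hq => ?_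
        obtain ⟨z, rfl⟩ := QuotientAddGroup.mk_surjective q
        exact hn ⟨z, (hinf B hB t ht z).1 hq⟩
      rw [hempty A hA hne, hempty A' hA' hne']
  have h1 := Finset.inclusion_exclusion_card_inf_compl 𝓙 (img A)
  have h2 := Finset.inclusion_exclusion_card_inf_compl 𝓙 (img A')
  have h3 : ((𝓙.inf fun i => (img A i)ᶜ).card : ℤ) = (𝓙.inf fun i => (img A' i)ᶜ).card := by
    rw [h1, h2]
    exact Finset.sum_congr rfl fun t ht => by rw [hcard t (Finset.mem_powerset.1 ht)]
  have h4 : (𝓙.inf fun i => (img A' i)ᶜ) = ∅ := by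
    refine Finset.eq_empty_of_forall_notMem fun q hq => ?_
    obtain ⟨z, rfl⟩ := QuotientAddGroup.mk_surjective q
    obtain ⟨i, hi, hz⟩ := hcovJ z
    exact Finset.mem_compl.1 ((Finset.mem_inf.1 hq) i hi) ((himg A' hA' i hi z).2 hz)
  have h5 : (𝓙.inf fun i => (img A i)ᶜ) = ∅ := by
    rw [h4, Finset.card_empty, Nat.cast_zero, Nat.cast_eq_zero] at h3
    exact Finset.card_eq_zero.1 h3
  by_contra! hcon
  refine Finset.notMem_empty (QuotientAddGroup.mk x : G ⧸ D) (h5 ▸ Finset.mem_inf.2 fun i hi => ?_)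
  rw [Finset.mem_compl, himg A hA i hi]
  exact hcon i (h𝓙 hi)

/-- Whether the fiber of a homomorphism meets a Boolean combination of subgroups depends only on
which projections of intersections of these subgroups contain the base point. -/
theorem exists_mem_fiber_of_same_pattern {V W : Type*} [AddCommGroup V] [AddCommGroup W]
    (π : W →+ V) (H : AddSubgroup W) (𝓚 : Finset (AddSubgroup W)) {v v' : V}
    (hpat : ∀ s ⊆ 𝓚, v ∈ (H ⊓ s.inf id).map π ↔ v' ∈ (H ⊓ s.inf id).map π)
    (hv : ∃ w, π w = v ∧ w ∈ H ∧ ∀ K ∈ 𝓚, w ∉ K) : ∃ w, π w = v' ∧ w ∈ H ∧ ∀ K ∈ 𝓚, w ∉ K := by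
  classical
  obtain ⟨w, hw, hwH, hwK⟩ := hv
  obtain ⟨w', ⟨hwH', -⟩, hw'⟩ := (hpat ∅ (Finset.empty_subset _)).1 ⟨w, by simpa using hwH, hw⟩
  by_contra! hcon
  -- The part of a fiber inside `H` is a translate `u + G`. Each `K` traces on it the empty set or a
  -- coset of `K ∩ G`, and which traces meet is read off from the projections.
  let G : AddSubgroup W := H ⊓ π.ker
  let A : W → AddSubgroup W → Set G := fun u K => {g | u + g ∈ K}
  have hA : ∀ u K, IsCosetOrEmpty (K.addSubgroupOf G) (A u K) := by
    intro u K x hx y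
    rw [AddSubgroup.mem_addSubgroupOf]
    have e : ((y - x : G) : W) = (u + y) - (u + x) := by
      rw [AddSubgroup.coe_sub]; abel
    rw [e]
    exact ⟨fun hy => K.sub_mem hy hx, fun hd => by
      simpa [A, add_comm] using K.add_mem hd hx⟩
  have hne : ∀ (u : W), u ∈ H → ∀ s : Finset (AddSubgroup W),
      (∃ x, ∀ K ∈ s, x ∈ A u K) ↔ π u ∈ (H ⊓ s.inf id).map π := by
    intro u hu s
    constructor
    · rintro ⟨x, hx⟩
      refine ⟨u + x, ⟨H.add_mem hu x.2.1, ?_⟩, ?_⟩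
      · exact AddSubgroup.mem_finset_inf_id.2 hx
      · rw [map_add, show π x = 0 from x.2.2, add_zero]
    · rintro ⟨z, ⟨hzH, hz⟩, hzu⟩
      refine ⟨⟨z - u, H.sub_mem hzH hu, ?_⟩, fun K hK => ?_⟩
      · simp [hzu]
      · have : z ∈ K := (Finset.inf_le hK : s.inf id ≤ id K) hz
        simpa [A] using this
  have hall := iUnion_eq_univ_of_same_pattern 𝓚 (fun K => K.addSubgroupOf G) (A w) (A w') (hA w)
    (hA w') (fun t ht => by rw [hne w hwH, hne w' hwH', hw, hw']; exact hpat t ht) (fun x => by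
      obtain ⟨K, hK, hx⟩ := hcon (w' + x) (by rw [map_add, show π x = 0 from x.2.2, add_zero, hw'])
        (H.add_mem hwH' x.2.1)
      exact ⟨K, hK, hx⟩) 0
  obtain ⟨K, hK, h0⟩ := hall
  exact hwK K hK (by simpa [A] using h0)

/-- The set `S` is a Boolean combination of finitely many subgroups: membership in `S` depends only
on membership in these subgroups. -/
def IsSubgroupCombination {V : Type*} [AddCommGroup V] (S : Set V) : Prop :=
  ∃ 𝓗 : Finset (AddSubgroup V), ∀ v v', (∀ H ∈ 𝓗, v ∈ H ↔ v' ∈ H) → (v ∈ S ↔ v' ∈ S)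

theorem IsSubgroupCombination.compl {V : Type*} [AddCommGroup V] {S : Set V}
    (h : IsSubgroupCombination S) : IsSubgroupCombination Sᶜ := by
  obtain ⟨𝓗, h⟩ := h
  exact ⟨𝓗, fun v v' hv => not_congr (h v v' hv)⟩

theorem IsSubgroupCombination.inter {V : Type*} [AddCommGroup V] {S S' : Set V}
    (h : IsSubgroupCombination S) (h' : IsSubgroupCombination S') :
    IsSubgroupCombination (S ∩ S') := by
  classical
  obtain ⟨𝓗, h⟩ := h
  obtain ⟨𝓗', h'⟩ := h'
  exact ⟨𝓗 ∪ 𝓗', fun v v' hv => and_congr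
    (h v v' fun H hH => hv H (Finset.mem_union_left _ hH))
    (h' v v' fun H hH => hv H (Finset.mem_union_right _ hH))⟩

theorem AddSubgroup.isSubgroupCombination {V : Type*} [AddCommGroup V] (H : AddSubgroup V) :
    IsSubgroupCombination (H : Set V) :=
  ⟨{H}, fun _ _ hv => hv H (Finset.mem_singleton_self H)⟩

/-- The projections of all intersections of the given subgroups suffice: if `v'` agrees with `v` on
them, its fiber contains a point in the same given subgroups as any chosen point over `v`. -/
theorem IsSubgroupCombination.image {V W : Type*} [AddCommGroup V] [AddCommGroup W] (π : W →+ V)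
    {S : Set W} (h : IsSubgroupCombination S) : IsSubgroupCombination (π '' S) := by
  classical
  obtain ⟨𝓗, h⟩ := h
  have key : ∀ v v', (∀ H ∈ 𝓗.powerset.image fun s => (s.inf id).map π, v ∈ H ↔ v' ∈ H) →
      v ∈ π '' S → v' ∈ π '' S := by
    rintro v v' hv ⟨w, hwS, hw⟩
    obtain ⟨w', hw', hH, hK⟩ := exists_mem_fiber_of_same_pattern π ((𝓗.filter (w ∈ ·)).inf id)
      (𝓗.filter (w ∉ ·)) (v := v) (v' := v') (fun s hs => by
        rw [← Finset.inf_union]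
        exact hv _ (Finset.mem_image_of_mem _ (Finset.mem_powerset.2
          (Finset.union_subset (Finset.filter_subset _ _) (hs.trans (Finset.filter_subset _ _))))))
      ⟨w, hw, AddSubgroup.mem_finset_inf_id.2 fun K hK => (Finset.mem_filter.1 hK).2,
        fun K hK => (Finset.mem_filter.1 hK).2⟩
    refine ⟨w', (h w w' fun H hH' => ?_).1 hwS, hw'⟩
    by_cases hwH : w ∈ H
    · refine iff_of_true hwH ?_
      exact (Finset.inf_le (Finset.mem_filter.2 ⟨hH', hwH⟩) :
        (𝓗.filter (w ∈ ·)).inf id ≤ id H) hH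
    · exact iff_of_false hwH (hK H (Finset.mem_filter.2 ⟨hH', hwH⟩))
  exact ⟨_, fun v v' hv => ⟨key v v' hv, key v' v fun H hH => (hv H hH).symm⟩⟩

end SubgroupCombinations

/-! ### Iterated limits along an ultrafilter -/

section DoubleLimits

open Filter

/-- The hypothesis `hc` says that `c i j` is a sum of a row term and a column term. Three corners of
a rectangle in `H` then force the fourth into `H`, so the two iterated limits agree. -/
theorem eventually_swap_mem_addSubgroup {V : Type*} [AddCommGroup V] (H : AddSubgroup V)
    (U : Ultrafilter ℕ) (c : ℕ → ℕ → V) (hc : ∀ i i' j j', c i j + c i' j' = c i j' + c i' j)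
    (h : ∀ᶠ i in U, ∀ᶠ j in U, c i j ∈ H) : ∀ᶠ j in U, ∀ᶠ i in U, c i j ∈ H := by
  by_contra hcon
  simp only [← Ultrafilter.eventually_not] at hcon
  obtain ⟨i₀, h₀⟩ := h.exists
  obtain ⟨j₁, h₀₁, hn⟩ := (h₀.and hcon).exists
  obtain ⟨i₁, h₁, hn₁⟩ := (h.and hn).exists
  obtain ⟨j₂, h₀₂, h₁₂⟩ := (h₀.and h₁).exists
  refine hn₁ ?_
  have e : c i₁ j₁ = c i₀ j₁ + c i₁ j₂ - c i₀ j₂ := by rw [hc i₀ i₁ j₁ j₂]; abel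
  rw [e]
  exact H.sub_mem (H.add_mem h₀₁ h₁₂) h₀₂

/-- A Boolean combination of subgroups does not order an infinite array of sums. -/
theorem IsSubgroupCombination.not_lt {V : Type*} [AddCommGroup V] {S : Set V}
    (h : IsSubgroupCombination S) (c : ℕ → ℕ → V)
    (hc : ∀ i i' j j', c i j + c i' j' = c i j' + c i' j) : ¬ ∀ i j, c i j ∈ S ↔ i < j := by
  intro hS
  obtain ⟨𝓗, h⟩ := h
  let U : Ultrafilter ℕ := hyperfilter ℕ
  have htruth : ∀ H : AddSubgroup V, ∃ τ : Prop, (∀ᶠ i in U, ∀ᶠ j in U, c i j ∈ H ↔ τ) ∧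
      ∀ᶠ j in U, ∀ᶠ i in U, c i j ∈ H ↔ τ := by
    intro H
    by_cases hH : ∀ᶠ i in U, ∀ᶠ j in U, c i j ∈ H
    · refine ⟨True, ?_⟩
      simp only [iff_true]
      exact ⟨hH, eventually_swap_mem_addSubgroup H U c hc hH⟩
    · have hH' : ¬ ∀ᶠ j in U, ∀ᶠ i in U, c i j ∈ H := fun h' =>
        hH (eventually_swap_mem_addSubgroup H U (fun i j => c j i)
          (fun i i' j j' => by rw [hc, add_comm]) h')
      refine ⟨False, ?_⟩
      simp only [iff_false]
      simp only [← Ultrafilter.eventually_not] at hH hH'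
      exact ⟨hH, hH'⟩
  choose τ hτ hτ' using htruth
  have hgt : ∀ i, ∀ᶠ j in (U : Filter ℕ), i < j := by
    intro i
    have : ∀ᶠ j in (atTop : Filter ℕ), i < j := eventually_gt_atTop i
    rw [← Nat.cofinite_eq_atTop] at this
    exact hyperfilter_le_cofinite this
  have h1 : ∀ᶠ i in U, ∀ᶠ j in U, ∀ H ∈ 𝓗, (c i j ∈ H ↔ τ H) :=
    ((eventually_all_finset 𝓗).2 fun H _ => hτ H).mono fun i hi => (eventually_all_finset 𝓗).2 hi
  have h2 : ∀ᶠ j in U, ∀ᶠ i in U, ∀ H ∈ 𝓗, (c i j ∈ H ↔ τ H) :=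
    ((eventually_all_finset 𝓗).2 fun H _ => hτ' H).mono fun i hi => (eventually_all_finset 𝓗).2 hi
  obtain ⟨i, hi⟩ := h1.exists
  obtain ⟨j, hj, hij⟩ := (hi.and (hgt i)).exists
  obtain ⟨j', hj'⟩ := h2.exists
  obtain ⟨i', hi', hij'⟩ := (hj'.and (hgt j')).exists
  -- A pair with `i < j` and a pair with `j' < i'` show the same limiting membership pattern.
  have := (h _ _ fun H hH => (hj H hH).trans (hi' H hH).symm).1 ((hS i j).2 hij)
  exact absurd ((hS i' j').1 this) (by omega)

end DoubleLimits

/-! ### Stability of abelian groups with a subgroup -/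

section AbelianStructures

variable {M : Type w} [groupLanguage.Structure M]

/-- The group structure of an abelian group with a distinguished subgroup. -/
abbrev IsAbelianGroupWithSubgroup.addCommGroup (h : IsAbelianGroupWithSubgroup M) :
    AddCommGroup M where
  add := gadd
  zero := gzero M
  neg := gneg
  add_assoc := h.add_assoc
  add_comm := h.add_comm
  zero_add := h.zero_add
  add_zero x := (h.add_comm x _).trans (h.zero_add x)
  neg_add_cancel := h.neg_add
  nsmul := @nsmulRec M ⟨gzero M⟩ ⟨gadd⟩
  zsmul := @zsmulRec M ⟨gzero M⟩ ⟨gadd⟩ ⟨gneg⟩ (@nsmulRec M ⟨gzero M⟩ ⟨gadd⟩)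

theorem exists_addMonoidHom_of_term (h : IsAbelianGroupWithSubgroup M) {β : Type*}
    (t : groupLanguage.Term β) :
    letI := h.addCommGroup
    ∃ f : (β → M) →+ M, ∀ v, t.realize v = f v := by
  let := h.addCommGroup
  induction t with
  | var b => exact ⟨Pi.evalAddMonoidHom _ b, fun _ => rfl⟩
  | func F ts ih =>
    choose f hf using ih
    cases F with
    | zero =>
      refine ⟨0, fun v => ?_⟩
      exact congrArg (Structure.funMap (L := groupLanguage) GroupFunc.zero) (Subsingleton.elim _ _)
    | neg =>
      refine ⟨-f 0, fun v => ?_⟩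
      refine (congrArg (Structure.funMap (L := groupLanguage) GroupFunc.neg)
        (funext fun i => ?_) : _ = gneg (f 0 v))
      rw [Subsingleton.elim i 0]
      exact hf 0 v
    | add =>
      refine ⟨f 0 + f 1, fun v => ?_⟩
      refine (congrArg (Structure.funMap (L := groupLanguage) GroupFunc.add)
        (funext fun i => ?_) : _ = gadd (f 0 v) (f 1 v))
      match i with
      | 0 => exact hf 0 v
      | 1 => exact hf 1 v

/-- Definable sets in an abelian group with a distinguished subgroup are Boolean combinations of
subgroups. -/
theorem isSubgroupCombination_of_formula (h : IsAbelianGroupWithSubgroup M) {α : Type*} {n : ℕ}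
    (φ : groupLanguage.BoundedFormula α n) :
    letI := h.addCommGroup
    IsSubgroupCombination
      {w : α ⊕ Fin n → M | φ.Realize (fun a => w (Sum.inl a)) fun i => w (Sum.inr i)} := by
  let := h.addCommGroup
  have helim : ∀ {n : ℕ} (w : α ⊕ Fin n → M),
      Sum.elim (fun a => w (Sum.inl a)) (fun i => w (Sum.inr i)) = w := by
    intro n w
    ext (i | i) <;> rfl
  induction φ with
  | falsum => exact ⟨∅, fun _ _ _ => Iff.rfl⟩
  | equal s t =>
    obtain ⟨f, hf⟩ := exists_addMonoidHom_of_term h s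
    obtain ⟨g, hg⟩ := exists_addMonoidHom_of_term h t
    convert! AddSubgroup.isSubgroupCombination (f - g).ker using 1
    ext w
    simp only [BoundedFormula.Realize, helim, mem_ofPred_eq, hf, hg, SetLike.mem_coe,
      AddMonoidHom.mem_ker, AddMonoidHom.sub_apply, sub_eq_zero]
  | rel R ts =>
    cases R with
    | pred =>
      obtain ⟨f, hf⟩ := exists_addMonoidHom_of_term h (ts 0)
      let Q : AddSubgroup M :=
        { carrier := predSet groupPred M
          zero_mem' := h.zero_mem
          add_mem' := fun {x y} hx hy => h.add_mem x hx y hy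
          neg_mem' := fun {x} hx => h.neg_mem x hx }
      convert! AddSubgroup.isSubgroupCombination (Q.comap f) using 1
      ext w
      simp only [BoundedFormula.Realize, helim, mem_ofPred_eq, SetLike.mem_coe,
        AddSubgroup.mem_comap]
      refine (iff_of_eq (congrArg (Structure.RelMap (L := groupLanguage) GroupRel.pred)
        (funext fun i => ?_)) : _ ↔ Structure.RelMap groupPred ![f w])
      rw [Subsingleton.elim i 0]
      exact hf w
  | imp _ _ ih₁ ih₂ =>
    convert! (ih₁.inter ih₂.compl).compl using 1
    ext w
    simp only [BoundedFormula.Realize, mem_ofPred_eq, mem_compl_iff, mem_inter_iff, not_and, not_not]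
  | @all n φ ih =>
    let π : (α ⊕ Fin (n + 1) → M) →+ (α ⊕ Fin n → M) :=
      { toFun := fun u i => u (Sum.map id Fin.castSucc i)
        map_zero' := rfl
        map_add' := fun _ _ => rfl }
    -- The universal quantifier is the complement of the projection of the complement.
    convert! (ih.compl.image π).compl using 1
    ext w
    simp only [BoundedFormula.Realize, mem_ofPred_eq, mem_compl_iff, mem_image, not_exists, not_and,
      not_imp_not]
    constructor
    · intro hw u hu
      subst hu
      have e : Fin.snoc (α := fun _ => M) (fun i => π u (Sum.inr i)) (u (Sum.inr (Fin.last n))) =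
          fun i => u (Sum.inr i) := by
        ext i
        refine Fin.lastCases ?_ (fun i => ?_) i <;> simp [π]
      exact e ▸ hw (u (Sum.inr (Fin.last n)))
    · intro hw x
      refine hw (Sum.elim (fun a => w (Sum.inl a)) (Fin.snoc (fun i => w (Sum.inr i)) x)) ?_
      ext (i | i) <;> simp [π]

/-- The concatenation of `a i` and `b j` is the sum of `(a i, 0)` and `(0, b j)`, so
`IsSubgroupCombination.not_lt` applies. -/
theorem isStable_of_abelian {T : groupLanguage.Theory}
    (hT : ∀ (M : Type w) [groupLanguage.Structure M] [M ⊨ T] [Nonempty M],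
      IsAbelianGroupWithSubgroup M) : IsStable.{0, 0, w} T := by
  rintro m n φ M _ _ _ ⟨a, b, hab⟩
  have h := hT M
  let := h.addCommGroup
  have h' := isSubgroupCombination_of_formula h φ
  refine h'.not_lt (fun i j => Sum.elim (Sum.elim (a i) (b j)) Fin.elim0) ?_ ?_
  · intro i i' j j'
    ext ((q | q) | q)
    · rfl
    · exact add_comm _ _
    · exact q.elim0
  · intro i j
    refine Iff.trans ?_ (hab i j)
    change BoundedFormula.Realize φ _ _ ↔ BoundedFormula.Realize φ _ _
    rw [Subsingleton.elim (fun q : Fin 0 => _) (default : Fin 0 → M)]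
    rfl

end AbelianStructures

/-! ### The Gaifman property from full existence -/

section Gaifman

open Filter

variable {L : FirstOrder.Language.{u, v}}

/-- An elementarily equivalent structure is named by an ultrafilter: the complete type of its
elements is the limit of the types of its maps into the given structure. -/
theorem exists_ultrafilter_of_models_completeTheory {Q N : Type w} [L.Structure Q] [L.Structure N]
    [Nonempty Q] (h : N ⊨ L.completeTheory Q) :
    ∃ U : Ultrafilter (N → Q), ∀ φ : L.Formula N,
      φ.Realize (id : N → N) ↔ ∀ᶠ v : N → Q in U, φ.Realize v := by
  classical
  let F : Filter (N → Q) := ⨅ p : {φ : L.Formula N // φ.Realize (id : N → N)}, 𝓟 {v | p.1.Realize v}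
  have : Nonempty {φ : L.Formula N // φ.Realize (id : N → N)} := ⟨⟨⊤, Formula.realize_top.2 trivial⟩⟩
  have hF : F.NeBot := by
    refine iInf_neBot_of_directed' ?_ ?_
    · rintro ⟨φ, hφ⟩ ⟨ψ, hψ⟩
      refine ⟨⟨φ ⊓ ψ, Formula.realize_inf.2 ⟨hφ, hψ⟩⟩, ?_, ?_⟩
      · exact principal_mono.2 fun v hv => (Formula.realize_inf.1 hv).1
      · exact principal_mono.2 fun v hv => (Formula.realize_inf.1 hv).2
    · rintro ⟨φ, hφ⟩
      refine principal_neBot_iff.2 ?_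
      have hN : φ.exClosure.Realize N := (Formula.realize_exClosure φ).2 ⟨fun a => a, by
        exact (BoundedFormula.realize_restrictFreeVar (φ := φ) (f := id) (v := fun a => (a : N))
          (id : N → N) (fun _ => rfl)).2 hφ⟩
      -- Elementary equivalence transfers the existential closure of `φ` to `Q`, so every generating
      -- set of the filter is nonempty.
      have hQ : φ.exClosure.Realize Q := by
        by_contra hn
        exact (Sentence.realize_not N).1 (Theory.realize_sentence_of_mem (L.completeTheory Q)
          (mem_completeTheory.2 ((Sentence.realize_not Q).2 hn))) hN
      obtain ⟨v, hv⟩ := (Formula.realize_exClosure φ).1 hQ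
      refine ⟨fun n => if hn : n ∈ φ.freeVarFinset then v ⟨n, hn⟩ else Classical.arbitrary Q, ?_⟩
      exact (BoundedFormula.realize_restrictFreeVar _ (by simp)).1 hv
  refine ⟨Ultrafilter.of F, fun φ => ?_⟩
  have hmem : ∀ φ : L.Formula N, φ.Realize (id : N → N) → ∀ᶠ v : N → Q in Ultrafilter.of F, φ.Realize v :=
    fun φ hφ => (Ultrafilter.of_le F).trans (iInf_le _ ⟨φ, hφ⟩) (mem_principal_self _)
  refine ⟨hmem φ, fun hφ => ?_⟩
  by_contra hn
  obtain ⟨v, hv, hv'⟩ := (hφ.and (hmem φ.not (Formula.realize_not.2 hn))).exists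
  exact Formula.realize_not.1 hv' hv

theorem mem_predSet_coe {P : L.Relations 1} {M : Type w} [L.Structure M]
    (S : L.Substructure M) (x : S) : x ∈ predSet P S ↔ (x : M) ∈ predSet P M := by
  refine iff_of_eq (congrArg (Structure.RelMap P) (funext fun i => ?_))
  rw [Subsingleton.elim i 0]
  rfl

theorem map_mem_predSet {P : L.Relations 1} {M N : Type*} [L.Structure M] [L.Structure N]
    (j : M ↪ₑ[L] N) (x : M) : j x ∈ predSet P N ↔ x ∈ predSet P M := by
  refine Iff.trans (iff_of_eq (congrArg (Structure.RelMap P) (funext fun i => ?_)))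
    (j.map_rel P ![x])
  rw [Subsingleton.elim i 0]
  rfl

/-- Full existence and uniform reduction imply the Gaifman property. -/
theorem hasGaifmanProperty_of_hasFullExistence {T : L.Theory} {P : L.Relations 1}
    (hfull : HasFullExistence.{u, v, w} T P) (hred : HasUniformReduction.{u, v, w} T P)
    (hclosed : ∀ (M : Type w) [L.Structure M] [M ⊨ T] [Nonempty M],
      (predPart P M : Set M) = predSet P M)
    (hne : ∀ (M : Type w) [L.Structure M] [M ⊨ T] [Nonempty M], (predSet P M).Nonempty) :
    HasGaifmanProperty.{u, v, w} T P := by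
  intro C _ _ _ N _ hN
  have hQ : ∀ x : predPart P C, (x : C) ∈ predSet P C := fun x => hclosed C ▸ x.2
  have : Nonempty (predPart P C) := by
    obtain ⟨x, hx⟩ := hne C
    exact ⟨⟨x, Substructure.subset_closure hx⟩⟩
  obtain ⟨U, hU⟩ := exists_ultrafilter_of_models_completeTheory hN
  let f : N → Ultrapower U C := fun n => ultraMk U fun v => (v n : C)
  have hfP : ∀ n, f n ∈ predSet P (Ultrapower U C) := fun n =>
    ultraMk_mem_predSet.2 (Eventually.of_forall fun v => hQ (v n))
  -- Uniform reduction expresses `ψ` on `P` by a formula `σ` of `C|_P`. The solution in the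
  -- ultrapower makes `∃ x, σ(x, t)` hold for almost all assignments, hence in `N`, and a solution
  -- in `N` is carried back by `f`.
  have hcomplete : IsCompleteSet P (range f) := by
    rintro m k ψ b hb ⟨a, haP, ha⟩
    choose t ht using hb
    let S : Set (Fin (m + k) → C) := {x | (∀ i, x i ∈ predSet P C) ∧
      ψ.Realize (Sum.elim (fun i => x (Fin.castAdd k i)) (fun i => x (Fin.natAdd m i)))}
    have hS : (∅ : Set C).Definable L S := by
      refine empty_definable_iff.2 ⟨(Formula.iInf fun i : Fin (m + k) =>
        P.formula₁ (Term.var i)) ⊓ ψ.relabel (Sum.elim (Fin.castAdd k) (Fin.natAdd m)), ?_⟩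
      ext x
      simp only [S, mem_ofPred_eq, Formula.realize_inf, Formula.realize_iInf,
        Formula.realize_rel₁, Term.realize_var, Formula.realize_relabel, predSet]
      refine and_congr Iff.rfl (iff_of_eq (congrArg _ (funext ?_)))
      rintro (i | i) <;> rfl
    obtain ⟨σ, hσ⟩ := empty_definable_iff.1 (hred C (m + k) S (fun a ha => ha.1) hS)
    have hσ' : ∀ q : Fin (m + k) → predPart P C,
        σ.Realize q ↔ ψ.Realize (Sum.elim (fun i => (q (Fin.castAdd k i) : C))
          (fun i => (q (Fin.natAdd m i) : C))) := by
      intro q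
      have h1 : q ∈ {a : Fin (m + k) → predPart P C | (fun i => (a i : C)) ∈ S} ↔ σ.Realize q := by
        rw [hσ]; rfl
      rw [← h1]
      exact ⟨fun h => h.2, fun h => ⟨fun i => hQ _, h⟩⟩
    choose a' ha' using fun i => ultraMk_surjective (a i)
    have hev : ∀ᶠ v in U, ψ.Realize (Sum.elim (fun i => a' i v) (fun i => (v (t i) : C))) := by
      have := (realize_ultraMk ψ (Sum.elim a' fun i v => (v (t i) : C)) _ (by
        rintro (i | i)
        · exact (ha' i).symm
        · exact (ht i).symm)).1 ha
      refine this.mono fun v hv => ?_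
      refine (iff_of_eq (congrArg ψ.Realize (funext ?_))).1 hv
      rintro (i | i) <;> rfl
    have hevP : ∀ᶠ v in U, ∀ i, a' i v ∈ predSet P C :=
      eventually_all.2 fun i => ultraMk_mem_predSet.1 ((ha' i).symm ▸ haP i)
    let τ : L.Formula N :=
      (σ.relabel (Fin.addCases (fun i => Sum.inr i) (fun i => Sum.inl (t i)))).iExs (Fin m)
    have hτ : ∀ (X : Type w) [L.Structure X] (v : N → X),
        τ.Realize v ↔ ∃ x : Fin m → X, σ.Realize (Fin.append x (v ∘ t)) := by
      intro X _ v
      rw [Formula.realize_iExs]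
      refine exists_congr fun x => ?_
      rw [Formula.realize_relabel]
      refine iff_of_eq (congrArg _ (funext fun i => ?_))
      refine Fin.addCases (fun i => ?_) (fun i => ?_) i <;> simp
    have hτN : τ.Realize (id : N → N) := by
      rw [hU]
      filter_upwards [hev, hevP] with v hv hvP
      refine (hτ _ v).2 ⟨fun i => ⟨a' i v, Substructure.subset_closure (hvP i)⟩, ?_⟩
      rw [hσ']
      simpa using hv
    obtain ⟨s, hs⟩ := (hτ N id).1 hτN
    have hs' : (σ.relabel (Fin.append s t)).Realize (id : N → N) := by
      rw [Formula.realize_relabel]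
      exact hs
    rw [hU] at hs'
    refine ⟨f ∘ s, fun i => ⟨⟨s i, rfl⟩, hfP _⟩, ?_⟩
    refine (realize_ultraMk ψ (Sum.elim (fun i v => (v (s i) : C)) fun i v => (v (t i) : C)) _ (by
        rintro (i | i)
        · rfl
        · exact (ht i).symm)).2 (hs'.mono fun v hv => ?_)
    rw [Formula.realize_relabel, hσ'] at hv
    refine (iff_of_eq (congrArg ψ.Realize (funext ?_))).1 hv
    rintro (i | i) <;> simp
  obtain ⟨C', _, j, N', hsub, heq⟩ := hfull (Ultrapower U C) (range f) hcomplete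
  have hT' : C' ⊨ T := (j.theory_model_iff T).1 inferInstance
  have hT'' : N' ⊨ T := (N'.theory_model_iff T).2 hT'
  have hne' : Nonempty C' := ⟨j (ultraMk U fun _ => Classical.arbitrary C)⟩
  have hne'' : Nonempty N' := N'.elementarilyEquivalent.nonempty_iff.2 hne'
  have hmem : ∀ n, j (f n) ∈ N' := fun n => hsub (mem_image_of_mem _ ⟨n, rfl⟩)
  have hmemP : ∀ n, (⟨j (f n), hmem n⟩ : N') ∈ predPart P N' := fun n =>
    Substructure.subset_closure ((mem_predSet_coe (N' : L.Substructure C') _).2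
      ((map_mem_predSet j _).2 (hfP n)))
  let g : N → predPart P N' := fun n => ⟨⟨j (f n), hmem n⟩, hmemP n⟩
  have hg : ∀ n, ((g n : N') : C') = j (f n) := fun n => rfl
  have hginj : Function.Injective g := by
    intro n n' hnn
    have h1 : j (f n) = j (f n') := by rw [← hg, ← hg, hnn]
    have h2 := ultraMk_eq_iff.1 (j.injective h1)
    have h3 := (hU (Term.equal (Term.var n) (Term.var n'))).2 (h2.mono fun v hv => by
      simpa [Formula.realize_equal] using Subtype.ext hv)
    simpa [Formula.realize_equal] using h3
  -- Here the existence property is used: the `P`-part of `N'` contains nothing beyond the image of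
  -- `N`.
  have hgsurj : Function.Surjective g := by
    intro x
    have hx : (x : N') ∈ predSet P N' := hclosed N' ▸ x.2
    have hx' : ((x : N') : C') ∈ (N' : Set C') ∩ predSet P C' :=
      ⟨x.1.2, (mem_predSet_coe (N' : L.Substructure C') _).1 hx⟩
    rw [heq] at hx'
    obtain ⟨⟨_, ⟨n, rfl⟩, hn⟩, -⟩ := hx'
    exact ⟨n, Subtype.ext (Subtype.ext hn)⟩
  refine ⟨N', inferInstance, hT'', hne'', ⟨⟨Equiv.ofBijective g ⟨hginj, hgsurj⟩, ?_, ?_⟩⟩⟩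
  · intro n F x
    have h1 := (hU (Term.equal (Term.var (Structure.funMap F x))
      (Term.func F fun i => Term.var (x i)))).1 (by simp [Formula.realize_equal])
    have h2 : f (Structure.funMap F x) = Structure.funMap F fun i => f (x i) := by
      have := (realize_ultraMk (U := U) (Term.equal (Term.var (Sum.inr 0))
        (Term.func F fun i => Term.var (Sum.inl i)) : L.Formula (Fin n ⊕ Fin 1))
        (Sum.elim (fun i v => (v (x i) : C)) fun _ v => (v (Structure.funMap F x) : C))
        (Sum.elim (fun i => f (x i)) fun _ => f (Structure.funMap F x))
        (by rintro (i | i) <;> rfl)).2 (h1.mono fun v hv => by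
          simp only [Formula.realize_equal, Term.realize_var, Term.realize_func] at hv ⊢
          exact congrArg Subtype.val hv)
      simpa [Formula.realize_equal] using this
    refine Subtype.ext (Subtype.ext ?_)
    change j (f (Structure.funMap F x)) = Structure.funMap F fun i => j (f (x i))
    rw [h2]
    exact j.map_fun F _
  · intro n R x
    have h1 := hU (R.formula fun i => Term.var (x i))
    have h2 := realize_ultraMk (U := U) (R.formula fun i => Term.var (x i) : L.Formula N)
      (fun y v => (v y : C)) f (fun _ => rfl)
    simp only [Formula.realize_rel, Term.realize_var, id] at h1 h2
    rw [h1]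
    change Structure.RelMap R (fun i => j (f (x i))) ↔ _
    refine (j.map_rel R fun i => f (x i)).trans (h2.trans Iff.rfl)

end Gaifman

/-! ### The language of groups -/

section Groups

theorem card_groupLanguage_le : groupLanguage.card ≤ Cardinal.aleph0 := by
  have h1 : Countable (Σ n, groupLanguage.Functions n) := by
    refine Function.Injective.countable (f := Sigma.fst) ?_
    rintro ⟨n, F⟩ ⟨n', F'⟩ h
    obtain rfl : n = n' := h
    cases F <;> cases F' <;> rfl
  have h2 : Countable (Σ n, groupLanguage.Relations n) := by
    refine Function.Injective.countable (f := Sigma.fst) ?_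
    rintro ⟨n, F⟩ ⟨n', F'⟩ h
    obtain rfl : n = n' := h
    cases F; cases F'; rfl
  exact Cardinal.mk_le_aleph0_iff.2 (inferInstanceAs
    (Countable ((Σ n, groupLanguage.Functions n) ⊕ (Σ n, groupLanguage.Relations n))))

theorem predPart_eq_predSet {M : Type w} [groupLanguage.Structure M]
    (h : IsAbelianGroupWithSubgroup M) : (predPart groupPred M : Set M) = predSet groupPred M := by
  let S : groupLanguage.Substructure M :=
    { carrier := predSet groupPred M
      fun_mem := by
        intro n F x hx
        cases F with
        | zero =>
          rw [Subsingleton.elim x (![])]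
          exact h.zero_mem
        | neg =>
          have e : x = ![x 0] := by
            ext i
            rw [Subsingleton.elim i 0]
            rfl
          rw [e]
          exact h.neg_mem _ (hx 0)
        | add =>
          have e : x = ![x 0, x 1] := by
            ext i
            match i with
            | 0 => rfl
            | 1 => rfl
          rw [e]
          exact h.add_mem _ (hx 0) _ (hx 1) }
  have : predPart groupPred M = S :=
    Substructure.closure_eq_of_le (S := S) subset_rfl Substructure.subset_closure
  rw [this]
  rfl

end Groups

end OverPredicate


/-! ### The theorem -/

theorem mainTheorem3 :
    -- full existence for countable stable theories, and the passage to the Morleyization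
    (∀ (L : FirstOrder.Language.{u, v}) (P : L.Relations 1) (T : L.Theory),
      L.card ≤ Cardinal.aleph0 → T.IsComplete → IsStable.{u, v, w} T →
        HasFullExistence.{u, v, w} T P ∧
        ((morleyLanguage L).card ≤ Cardinal.aleph0 ∧
          (morleyization T).IsComplete ∧
          IsStable.{u, max u v, w} (morleyization T) ∧
          IsStablyEmbedded.{u, max u v, w} (morleyization T) (Sum.inl P) ∧
          HasUniformReduction.{u, max u v, w} (morleyization T) (Sum.inl P) ∧
          HasPredicateElimination (morleyization T) ∧
          ∀ (M : Type w) [L.Structure M] [M ⊨ T] [Nonempty M],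
            M ⊨ morleyization T ∧
            ∀ A : Set M, IsCompleteSet P A ↔
              IsCompleteSet (L := morleyLanguage L) (Sum.inl P) A)) ∧
    -- full existence for abelian groups with a distinguished subgroup
    (∀ T : groupLanguage.Theory, T.IsComplete →
      (∀ (M : Type w) [groupLanguage.Structure M] [M ⊨ T] [Nonempty M],
        IsAbelianGroupWithSubgroup M) →
        HasFullExistence.{0, 0, w} T groupPred ∧
        (HasUniformReduction.{0, 0, w} T groupPred →
          HasGaifmanProperty.{0, 0, w} T groupPred)) := by
  refine ⟨fun L P T hL hc hT => ⟨hasFullExistence_of_isStable P hL hT, card_morleyLanguage_le hL,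
    morleyization_isComplete hc, morleyization_isStable hT,
    isStablyEmbedded_of_isStable _ (morleyization_isStable hT),
    morleyization_hasUniformReduction T _, morleyization_hasPredicateElimination T,
    fun M _ _ _ => ⟨inferInstance, isCompleteSet_morleyization_iff P⟩⟩, fun T _ hT => ?_⟩
  have hfull : HasFullExistence.{0, 0, w} T groupPred :=
    hasFullExistence_of_isStable groupPred card_groupLanguage_le (isStable_of_abelian hT)
  exact ⟨hfull, fun hred => hasGaifmanProperty_of_hasFullExistence hfull hred
    (fun M _ _ _ => predPart_eq_predSet (hT M)) fun M _ _ _ => ⟨gzero M, (hT M).zero_mem⟩⟩
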